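/- Let $1<p<q<5$ and $p<\frac73$. For every $\omega>0$ the equation $$-\varphi''+\omega\varphi+|\varphi|^{p-1}\varphi-|\varphi|^{q-1}\varphi=0\quad\text{on }\mathbb R$$ has a positive solution $\varphi\in C^2(\mathbb R)\cap H^1(\mathbb R)$, i.e. the nonlinear Schrödinger equation $i\partial_tu+\partial_x^2u-|u|^{p-1}u+|u|^{q-1}u=0$ has a standing wave $e^{i\omega t}\varphi(x)$ with $\varphi$ positive. For each $\omega>0$ let $\phi_\omega$ be any such solution, and put $M(\omega)=\frac12\int_{\mathbb R}\phi_\omega(x)^2\,dx$. Then $M$ is differentiable on $(0,\infty)$, the limit $\lim_{\omega\downarrow0}M'(\omega)$ exists in $\mathbb R$, and $$\operatorname{sgn}\Bigl(\lim_{\omega\downarrow0}M'(\omega)\Bigr)=\begin{cases}-1&\text{if }2p+q>7,\\ 0&\text{if }2p+q=7,\\ 1&\text{if }2p+q<7.\end{cases}$$ In particular, $\lim_{\omega\downarrow0}\operatorname{sgn}M'(\omega)=-1$ if $2p+q>7$, and $\lim_{\omega\downarrow0}\operatorname{sgn}M'(\omega)=1$ if $2p+q<7$. -/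

import Mathlib

open Filter Topology MeasureTheory

/-- `φ` is a profile of a standing wave `u(t,x) = e^{iωt} φ(x)` of the one-dimensional equation
`i ∂ₜu + ∂ₓ²u - |u|^{p-1} u + |u|^{q-1} u = 0`: a positive classical solution, lying in `H¹(ℝ)`, of
`-φ'' + ω φ + |φ|^{p-1} φ - |φ|^{q-1} φ = 0` on the line. -/
structure IsStandingWaveProfile (p q ω : ℝ) (φ : ℝ → ℝ) : Prop where
  contDiff : ContDiff ℝ 2 φ
  pos : ∀ x, 0 < φ x
  memLp : MemLp φ 2 volume
  memLp_deriv : MemLp (deriv φ) 2 volume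
  equation : ∀ x, -(deriv (deriv φ) x) + ω * φ x + |φ x| ^ (p - 1) * φ x
    - |φ x| ^ (q - 1) * φ x = 0

/-- `M(ω) = (1/2) ∫ φ_ω(x)² dx` for a family of profiles `ω ↦ φ_ω`. -/
noncomputable def standingWaveMass (φ : ℝ → ℝ → ℝ) (ω : ℝ) : ℝ :=
  (1 / 2) * ∫ x, (φ ω x) ^ 2

/-! ### Elementary bounds for real powers on the unit interval -/

theorem one_sub_rpow_le {s t : ℝ} (hs : 0 < s) (ht : 0 ≤ t) (ht1 : t ≤ 1) :
    1 - t ^ s ≤ (1 + s) * (1 - t) := by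
  rcases le_total 1 s with h | h
  · have := one_add_mul_self_le_rpow_one_add (s := t - 1) (by linarith) h
    rw [add_sub_cancel] at this
    nlinarith
  · have := Real.rpow_le_rpow_of_exponent_ge' ht ht1 hs.le h
    rw [Real.rpow_one] at this
    nlinarith

theorem mul_one_sub_le_one_sub_rpow {s t : ℝ} (hs : 0 < s) (ht : 0 ≤ t) (ht1 : t ≤ 1) :
    min 1 s * (1 - t) ≤ 1 - t ^ s := by
  rcases le_total 1 s with h | h
  · rw [min_eq_left h]
    have := Real.rpow_le_rpow_of_exponent_ge' ht ht1 zero_le_one h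
    rw [Real.rpow_one] at this
    linarith
  · rw [min_eq_right h]
    have := rpow_one_add_le_one_add_mul_self (s := t - 1) (by linarith) hs.le h
    rw [add_sub_cancel] at this
    linarith

theorem integrableOn_rpow_mul_one_sub_rpow {x : ℝ} (hx : -1 < x) :
    IntegrableOn (fun t : ℝ => t ^ x * (1 - t) ^ (-(1 / 2) : ℝ)) (Set.Ioo 0 1) := by
  have h := Complex.betaIntegral_convergent (u := ((x + 1 : ℝ) : ℂ)) (v := ((1 / 2 : ℝ) : ℂ))
    (by rw [Complex.ofReal_re]; linarith) (by rw [Complex.ofReal_re]; norm_num)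
  rw [intervalIntegrable_iff_integrableOn_Ioo_of_le zero_le_one] at h
  refine IntegrableOn.congr_fun (Integrable.norm h) (fun t ht => ?_) measurableSet_Ioo
  have h1 : (0 : ℝ) < 1 - t := by linarith [ht.2]
  have e : (1 - (t : ℂ)) = ((1 - t : ℝ) : ℂ) := by push_cast; rfl
  simp only [norm_mul]
  rw [e, Complex.norm_cpow_eq_rpow_re_of_pos ht.1, Complex.norm_cpow_eq_rpow_re_of_pos h1]
  congr 2
  · simp
  · simp [Complex.sub_re]; norm_num

/-! ### The amplitude of the profiles -/

/-- The exponents `α = p - 1` and `β = q - 1` of the two powers. -/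
structure PowerPair where
  α : ℝ
  β : ℝ
  α_pos : 0 < α
  lt : α < β
  α_lt : α < 4 / 3

namespace PowerPair

variable (P : PowerPair)

noncomputable def b : ℝ := 2 / (P.α + 2)

noncomputable def c : ℝ := 2 / (P.β + 2)

theorem β_pos : 0 < P.β := P.α_pos.trans P.lt

theorem b_pos : 0 < P.b := div_pos two_pos (by linarith [P.α_pos])

theorem c_pos : 0 < P.c := div_pos two_pos (by linarith [P.β_pos])

/-- The frequency of the profile with maximum `a`. -/
noncomputable def freq (a : ℝ) : ℝ := P.c * a ^ P.β - P.b * a ^ P.α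

noncomputable def freqDeriv (a : ℝ) : ℝ :=
  P.c * (P.β * a ^ (P.β - 1)) - P.b * (P.α * a ^ (P.α - 1))

/-- The maximum of the profile of zero frequency. -/
noncomputable def amp₀ : ℝ := (P.b / P.c) ^ (P.β - P.α)⁻¹

theorem amp₀_pos : 0 < P.amp₀ := Real.rpow_pos_of_pos (div_pos P.b_pos P.c_pos) _

theorem amp₀_rpow_sub : P.c * P.amp₀ ^ (P.β - P.α) = P.b := by
  have h : P.β - P.α ≠ 0 := by linarith [P.lt]
  rw [amp₀, Real.rpow_inv_rpow (div_pos P.b_pos P.c_pos).le h]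
  field_simp [P.c_pos.ne']

theorem freq_eq {a : ℝ} (ha : 0 < a) : P.freq a = a ^ P.α * (P.c * a ^ (P.β - P.α) - P.b) := by
  rw [freq, Real.rpow_sub ha]
  field_simp

theorem freq_amp₀ : P.freq P.amp₀ = 0 := by
  rw [P.freq_eq P.amp₀_pos, P.amp₀_rpow_sub, sub_self, mul_zero]

theorem freq_strictMonoOn : StrictMonoOn P.freq (Set.Ici P.amp₀) := by
  intro x hx y hy hxy
  have hx0 : 0 < x := P.amp₀_pos.trans_le hx
  have hr : 0 < P.β - P.α := sub_pos.2 P.lt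
  rw [P.freq_eq hx0, P.freq_eq (hx0.trans hxy)]
  have h1 : P.c * P.amp₀ ^ (P.β - P.α) ≤ P.c * x ^ (P.β - P.α) :=
    mul_le_mul_of_nonneg_left (Real.rpow_le_rpow P.amp₀_pos.le hx hr.le) P.c_pos.le
  rw [P.amp₀_rpow_sub] at h1
  have h2 : P.c * x ^ (P.β - P.α) < P.c * y ^ (P.β - P.α) :=
    mul_lt_mul_of_pos_left (Real.rpow_lt_rpow hx0.le hxy hr) P.c_pos
  have h3 : x ^ P.α ≤ y ^ P.α := Real.rpow_le_rpow hx0.le hxy.le P.α_pos.le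
  exact mul_lt_mul'' (Real.rpow_lt_rpow hx0.le hxy P.α_pos) (by linarith)
    (Real.rpow_nonneg hx0.le _) (by linarith)

theorem hasDerivAt_freq {a : ℝ} (ha : 0 < a) : HasDerivAt P.freq (P.freqDeriv a) a :=
  ((Real.hasDerivAt_rpow_const (Or.inl ha.ne')).const_mul P.c).sub
    ((Real.hasDerivAt_rpow_const (Or.inl ha.ne')).const_mul P.b)

theorem freq_nonneg {a : ℝ} (ha : P.amp₀ ≤ a) : 0 ≤ P.freq a := by
  rw [← P.freq_amp₀]
  exact P.freq_strictMonoOn.monotoneOn Set.self_mem_Ici ha ha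

theorem freq_pos {a : ℝ} (ha : P.amp₀ < a) : 0 < P.freq a := by
  rw [← P.freq_amp₀]
  exact P.freq_strictMonoOn Set.self_mem_Ici ha.le ha

theorem mul_freqDeriv {a : ℝ} (ha : 0 < a) :
    a * P.freqDeriv a = P.β * P.freq a + (P.β - P.α) * (P.b * a ^ P.α) := by
  rw [freqDeriv, freq, Real.rpow_sub_one ha.ne', Real.rpow_sub_one ha.ne']
  field_simp
  ring

theorem freqDeriv_pos {a : ℝ} (ha : P.amp₀ ≤ a) : 0 < P.freqDeriv a := by
  have ha0 := P.amp₀_pos.trans_le ha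
  refine pos_of_mul_pos_right (a := a) ?_ ha0.le
  rw [P.mul_freqDeriv ha0]
  have h1 := mul_nonneg P.β_pos.le (P.freq_nonneg ha)
  have h2 := mul_pos (sub_pos.2 P.lt) (mul_pos P.b_pos (Real.rpow_pos_of_pos ha0 P.α))
  linarith

theorem continuousOn_freqDeriv : ContinuousOn P.freqDeriv (Set.Ioi 0) := by
  intro a ha
  refine ContinuousAt.continuousWithinAt ?_
  have ha' : a ≠ 0 := ne_of_gt ha
  unfold freqDeriv
  exact (((Real.continuousAt_rpow_const _ _ (Or.inl ha')).const_mul _).const_mul _).sub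
    (((Real.continuousAt_rpow_const _ _ (Or.inl ha')).const_mul _).const_mul _)

theorem exists_freq_eq {ω : ℝ} (hω : 0 < ω) : ∃ a, P.amp₀ < a ∧ P.freq a = ω := by
  have hr : 0 < P.β - P.α := sub_pos.2 P.lt
  have ht : Tendsto P.freq atTop atTop := by
    have h1 : Tendsto (fun a : ℝ => a ^ P.α * (P.c * a ^ (P.β - P.α) - P.b)) atTop atTop :=
      (tendsto_rpow_atTop P.α_pos).atTop_mul_atTop₀
        (tendsto_atTop_add_const_right _ _ ((tendsto_rpow_atTop hr).const_mul_atTop P.c_pos))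
    refine h1.congr' ?_
    filter_upwards [eventually_gt_atTop 0] with a ha
    exact (P.freq_eq ha).symm
  obtain ⟨y, hy, hy'⟩ := ((ht.eventually_gt_atTop ω).and (eventually_gt_atTop P.amp₀)).exists
  have hc : ContinuousOn P.freq (Set.Icc P.amp₀ y) := fun a ha =>
    (P.hasDerivAt_freq (P.amp₀_pos.trans_le ha.1)).continuousAt.continuousWithinAt
  obtain ⟨a, ha, he⟩ := intermediate_value_Ioo hy'.le hc ⟨by rwa [P.freq_amp₀], hy⟩
  exact ⟨a, ha.1, he⟩

open Classical in
/-- The maximum of the profile of frequency `ω`. -/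
noncomputable def amp (ω : ℝ) : ℝ := if h : 0 < ω then (P.exists_freq_eq h).choose else P.amp₀

theorem amp_gt {ω : ℝ} (hω : 0 < ω) : P.amp₀ < P.amp ω := by
  rw [amp, dif_pos hω]; exact (P.exists_freq_eq hω).choose_spec.1

theorem freq_amp {ω : ℝ} (hω : 0 < ω) : P.freq (P.amp ω) = ω := by
  rw [amp, dif_pos hω]; exact (P.exists_freq_eq hω).choose_spec.2

theorem lt_amp {ω a : ℝ} (hω : 0 < ω) (ha : P.amp₀ ≤ a) (h : P.freq a < ω) : a < P.amp ω := by
  rwa [← P.freq_strictMonoOn.lt_iff_lt ha (P.amp_gt hω).le, P.freq_amp hω]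

theorem amp_lt {ω a : ℝ} (hω : 0 < ω) (ha : P.amp₀ ≤ a) (h : ω < P.freq a) : P.amp ω < a := by
  rwa [← P.freq_strictMonoOn.lt_iff_lt (P.amp_gt hω).le ha, P.freq_amp hω]

theorem continuousAt_amp {ω : ℝ} (hω : 0 < ω) : ContinuousAt P.amp ω := by
  have hpos : ∀ᶠ x in 𝓝 ω, 0 < x := eventually_gt_nhds hω
  refine tendsto_order.2 ⟨fun l hl => ?_, fun u hu => ?_⟩
  · rcases le_or_gt l P.amp₀ with h | h
    · filter_upwards [hpos] with x hx using h.trans_lt (P.amp_gt hx)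
    · have : P.freq l < ω := by
        rw [← P.freq_amp hω]; exact P.freq_strictMonoOn h.le (P.amp_gt hω).le hl
      filter_upwards [hpos, eventually_gt_nhds this] with x hx hx' using P.lt_amp hx h.le hx'
  · have h := (P.amp_gt hω).trans hu
    have : ω < P.freq u := by
      rw [← P.freq_amp hω]; exact P.freq_strictMonoOn (P.amp_gt hω).le h.le hu
    filter_upwards [hpos, eventually_lt_nhds this] with x hx hx' using P.amp_lt hx h.le hx'

theorem tendsto_amp : Tendsto P.amp (𝓝[>] 0) (𝓝[>] P.amp₀) := by
  have hpos : ∀ᶠ x : ℝ in 𝓝[>] 0, 0 < x := eventually_mem_nhdsWithin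
  refine tendsto_nhdsWithin_iff.2 ⟨tendsto_order.2 ⟨fun l hl => ?_, fun u hu => ?_⟩, ?_⟩
  · filter_upwards [hpos] with x hx using hl.trans (P.amp_gt hx)
  · filter_upwards [hpos, (eventually_lt_nhds (P.freq_pos hu)).filter_mono nhdsWithin_le_nhds]
      with x hx hx' using P.amp_lt hx hu.le hx'
  · filter_upwards [hpos] with x hx using P.amp_gt hx

theorem hasDerivAt_amp {ω : ℝ} (hω : 0 < ω) :
    HasDerivAt P.amp (P.freqDeriv (P.amp ω))⁻¹ ω := by
  have h := (P.amp_gt hω)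
  refine HasDerivAt.of_local_left_inverse (P.continuousAt_amp hω)
    (P.hasDerivAt_freq (P.amp₀_pos.trans h)) (P.freqDeriv_pos h.le).ne' ?_
  filter_upwards [eventually_gt_nhds hω] with x hx using P.freq_amp hx

/-! ### The reduced potential -/

/-- For `0 < t` this is `ω + b (a t)^α - c (a t)^β` with `ω = freq a`; a profile `φ` with
maximum `a` satisfies `φ'² = φ² * pot a (φ / a)`. -/
noncomputable def pot (a t : ℝ) : ℝ :=
  P.freq a * (1 - t ^ P.β) + P.b * a ^ P.α * (t ^ P.α - t ^ P.β)

noncomputable def potDeriv (a t : ℝ) : ℝ :=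
  P.freqDeriv a * (1 - t ^ P.β) + P.b * (P.α * a ^ (P.α - 1)) * (t ^ P.α - t ^ P.β)

theorem pot_eq {a t : ℝ} (ha : 0 < a) (ht : 0 ≤ t) :
    P.pot a t = P.freq a + P.b * (a * t) ^ P.α - P.c * (a * t) ^ P.β := by
  rw [Real.mul_rpow ha.le ht, Real.mul_rpow ha.le ht, pot, freq]
  ring

theorem hasDerivAt_pot {a : ℝ} (ha : 0 < a) (t : ℝ) :
    HasDerivAt (fun a => P.pot a t) (P.potDeriv a t) a :=
  ((P.hasDerivAt_freq ha).mul_const _).add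
    (((Real.hasDerivAt_rpow_const (Or.inl ha.ne')).const_mul P.b).mul_const _)

theorem continuous_pot (a : ℝ) : Continuous (P.pot a) := by
  unfold pot
  have h1 := Real.continuous_rpow_const P.α_pos.le
  have h2 := Real.continuous_rpow_const P.β_pos.le
  fun_prop

theorem continuous_potDeriv (a : ℝ) : Continuous (P.potDeriv a) := by
  unfold potDeriv
  have h1 := Real.continuous_rpow_const P.α_pos.le
  have h2 := Real.continuous_rpow_const P.β_pos.le
  fun_prop

theorem pot_one (a : ℝ) : P.pot a 1 = 0 := by simp [pot]

theorem pot_neg {a t : ℝ} (ha : P.amp₀ ≤ a) (ht : 1 < t) : P.pot a t < 0 := by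
  have h1 : t ^ P.α < t ^ P.β := Real.rpow_lt_rpow_of_exponent_lt ht P.lt
  have h2 : 1 < t ^ P.β := Real.one_lt_rpow ht P.β_pos
  have h3 := P.freq_nonneg ha
  have h4 := mul_pos P.b_pos (Real.rpow_pos_of_pos (P.amp₀_pos.trans_le ha) P.α)
  unfold pot
  nlinarith

/-- A constant for which `potConst * (t^α * (1 - t))` bounds all `pot a` with `amp₀ ≤ a`. -/
noncomputable def potConst : ℝ := P.b * P.amp₀ ^ P.α * min 1 (P.β - P.α)

theorem potConst_pos : 0 < P.potConst :=
  mul_pos (mul_pos P.b_pos (Real.rpow_pos_of_pos P.amp₀_pos _))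
    (lt_min one_pos (sub_pos.2 P.lt))

theorem rpow_sub_rpow_ge {t : ℝ} (ht : 0 < t) (ht1 : t ≤ 1) :
    min 1 (P.β - P.α) * (t ^ P.α * (1 - t)) ≤ t ^ P.α - t ^ P.β := by
  have h := mul_one_sub_le_one_sub_rpow (sub_pos.2 P.lt) ht.le ht1
  have e : t ^ P.β = t ^ P.α * t ^ (P.β - P.α) := by rw [← Real.rpow_add ht]; ring_nf
  rw [e]
  nlinarith [Real.rpow_pos_of_pos ht P.α]

theorem potConst_mul_le {a t : ℝ} (ha : P.amp₀ ≤ a) (ht : 0 < t) (ht1 : t ≤ 1) :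
    P.potConst * (t ^ P.α * (1 - t)) ≤ P.pot a t := by
  have h1 := P.rpow_sub_rpow_ge ht ht1
  have h2 : 0 ≤ 1 - t ^ P.β := sub_nonneg.2 (Real.rpow_le_one ht.le ht1 P.β_pos.le)
  have h3 : P.b * P.amp₀ ^ P.α ≤ P.b * a ^ P.α :=
    mul_le_mul_of_nonneg_left (Real.rpow_le_rpow P.amp₀_pos.le ha P.α_pos.le) P.b_pos.le
  have h4 : 0 ≤ P.b * P.amp₀ ^ P.α := mul_nonneg P.b_pos.le (Real.rpow_nonneg P.amp₀_pos.le _)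
  have h5 : 0 ≤ t ^ P.α - t ^ P.β := sub_nonneg.2
    (Real.rpow_le_rpow_of_exponent_ge ht ht1 P.lt.le)
  have h6 := mul_le_mul h3 h1 (mul_nonneg (le_min zero_le_one (sub_pos.2 P.lt).le)
    (mul_nonneg (Real.rpow_nonneg ht.le _) (by linarith))) (h4.trans h3)
  have h7 := mul_nonneg (P.freq_nonneg ha) h2
  unfold pot potConst
  nlinarith

theorem pot_pos {a t : ℝ} (ha : P.amp₀ ≤ a) (ht : 0 < t) (ht1 : t < 1) : 0 < P.pot a t :=
  (mul_pos P.potConst_pos (mul_pos (Real.rpow_pos_of_pos ht _) (by linarith))).trans_le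
    (P.potConst_mul_le ha ht ht1.le)

theorem pot_rpow_neg_le {a t s : ℝ} (ha : P.amp₀ ≤ a) (ht : 0 < t) (ht1 : t < 1) (hs : 0 ≤ s) :
    P.pot a t ^ (-s) ≤ P.potConst ^ (-s) * (t ^ (-(P.α * s)) * (1 - t) ^ (-s)) := by
  have h1 : 0 < 1 - t := by linarith
  have h := Real.rpow_le_rpow_of_nonpos (mul_pos P.potConst_pos
    (mul_pos (Real.rpow_pos_of_pos ht P.α) h1)) (P.potConst_mul_le ha ht ht1.le)
    (neg_nonpos.2 hs)
  rwa [Real.mul_rpow P.potConst_pos.le (mul_pos (Real.rpow_pos_of_pos ht P.α) h1).le,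
    Real.mul_rpow (Real.rpow_nonneg ht.le _) h1.le, ← Real.rpow_mul ht.le, mul_neg] at h

end PowerPair

namespace PowerPair

variable (P : PowerPair)

/-! ### Half the mass as a function of the maximum -/

noncomputable def massIntegrand (a t : ℝ) : ℝ := a ^ 2 * (t * P.pot a t ^ (-(1 / 2) : ℝ))

noncomputable def massIntegrandDeriv (a t : ℝ) : ℝ :=
  2 * a * (t * P.pot a t ^ (-(1 / 2) : ℝ)) +
    a ^ 2 * (t * (P.potDeriv a t * (-(1 / 2)) * P.pot a t ^ (-(3 / 2) : ℝ)))

/-- The integral of `φ²` over a half-line starting at the maximum `a` of `φ`. -/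
noncomputable def halfIntegral (a : ℝ) : ℝ := ∫ t in Set.Ioo 0 1, P.massIntegrand a t

noncomputable def halfIntegralDeriv (a : ℝ) : ℝ := ∫ t in Set.Ioo 0 1, P.massIntegrandDeriv a t

noncomputable def dominant (t : ℝ) : ℝ := t ^ (1 - P.α * (3 / 2)) * (1 - t) ^ (-(1 / 2) : ℝ)

theorem integrableOn_dominant : IntegrableOn P.dominant (Set.Ioo 0 1) :=
  integrableOn_rpow_mul_one_sub_rpow (by linarith [P.α_lt])

theorem mul_pot_rpow_le {a t : ℝ} (ha : P.amp₀ ≤ a) (ht : 0 < t) (ht1 : t < 1) :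
    t * P.pot a t ^ (-(1 / 2) : ℝ) ≤ P.potConst ^ (-(1 / 2) : ℝ) * P.dominant t := by
  have h1 : 0 < 1 - t := by linarith
  have h := P.pot_rpow_neg_le ha ht ht1 (s := 1 / 2) (by norm_num)
  have h2 : t * t ^ (-(P.α * (1 / 2))) ≤ t ^ (1 - P.α * (3 / 2)) := by
    rw [← Real.rpow_one_add' ht.le (by linarith [P.α_lt])]
    exact Real.rpow_le_rpow_of_exponent_ge ht ht1.le (by linarith [P.α_pos])
  have h3 := Real.rpow_nonneg P.potConst_pos.le (-(1 / 2) : ℝ)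
  have h4 := Real.rpow_nonneg h1.le (-(1 / 2) : ℝ)
  calc t * P.pot a t ^ (-(1 / 2) : ℝ)
      ≤ t * (P.potConst ^ (-(1 / 2) : ℝ) * (t ^ (-(P.α * (1 / 2))) * (1 - t) ^ (-(1 / 2) : ℝ))) :=
        mul_le_mul_of_nonneg_left h ht.le
    _ = P.potConst ^ (-(1 / 2) : ℝ) *
          ((t * t ^ (-(P.α * (1 / 2)))) * (1 - t) ^ (-(1 / 2) : ℝ)) := by ring
    _ ≤ _ := mul_le_mul_of_nonneg_left (mul_le_mul_of_nonneg_right h2 h4) h3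

theorem mul_one_sub_mul_pot_rpow_le {a t : ℝ} (ha : P.amp₀ ≤ a) (ht : 0 < t) (ht1 : t < 1) :
    t * ((1 - t) * P.pot a t ^ (-(3 / 2) : ℝ)) ≤
      P.potConst ^ (-(3 / 2) : ℝ) * P.dominant t := by
  have h1 : 0 < 1 - t := by linarith
  have h := P.pot_rpow_neg_le ha ht ht1 (s := 3 / 2) (by norm_num)
  have e1 : t * t ^ (-(P.α * (3 / 2))) = t ^ (1 - P.α * (3 / 2)) := by
    rw [sub_eq_add_neg, Real.rpow_add ht, Real.rpow_one]
  have e2 : (1 - t) * (1 - t) ^ (-(3 / 2) : ℝ) = (1 - t) ^ (-(1 / 2) : ℝ) := by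
    rw [← Real.rpow_one_add' h1.le (by norm_num)]; norm_num
  calc t * ((1 - t) * P.pot a t ^ (-(3 / 2) : ℝ))
      ≤ t * ((1 - t) * (P.potConst ^ (-(3 / 2) : ℝ) *
          (t ^ (-(P.α * (3 / 2))) * (1 - t) ^ (-(3 / 2) : ℝ)))) :=
        mul_le_mul_of_nonneg_left (mul_le_mul_of_nonneg_left h h1.le) ht.le
    _ = P.potConst ^ (-(3 / 2) : ℝ) *
          ((t * t ^ (-(P.α * (3 / 2)))) * ((1 - t) * (1 - t) ^ (-(3 / 2) : ℝ))) := by ring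
    _ = _ := by rw [e1, e2, dominant]

theorem measurable_massIntegrand (a : ℝ) : Measurable (P.massIntegrand a) :=
  (measurable_id.mul ((P.continuous_pot a).measurable.pow_const _)).const_mul _

theorem measurable_massIntegrandDeriv (a : ℝ) : Measurable (P.massIntegrandDeriv a) :=
  ((measurable_id.mul ((P.continuous_pot a).measurable.pow_const _)).const_mul _).add
    ((measurable_id.mul (((P.continuous_potDeriv a).measurable.mul_const _).mul
      ((P.continuous_pot a).measurable.pow_const _))).const_mul _)

theorem integrableOn_massIntegrand {a : ℝ} (ha : P.amp₀ ≤ a) :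
    IntegrableOn (P.massIntegrand a) (Set.Ioo 0 1) := by
  refine Integrable.mono' ((P.integrableOn_dominant.const_mul (P.potConst ^ (-(1 / 2) : ℝ))).const_mul
    (a ^ 2)) (P.measurable_massIntegrand a).aestronglyMeasurable ?_
  filter_upwards [ae_restrict_mem measurableSet_Ioo] with t ht
  rw [massIntegrand, Real.norm_of_nonneg (mul_nonneg (sq_nonneg a) (mul_nonneg ht.1.le
    (Real.rpow_nonneg (P.pot_pos ha ht.1 ht.2).le _)))]
  exact mul_le_mul_of_nonneg_left (P.mul_pot_rpow_le ha ht.1 ht.2) (sq_nonneg a)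

theorem exists_abs_potDeriv_le (A : ℝ) : ∃ K, 0 ≤ K ∧ ∀ a ∈ Set.Icc P.amp₀ A,
    ∀ t ∈ Set.Ioo (0 : ℝ) 1, |P.potDeriv a t| ≤ K * (1 - t) := by
  have hc : ContinuousOn (fun a => |P.freqDeriv a| + P.b * (P.α * a ^ (P.α - 1)))
      (Set.Icc P.amp₀ A) := by
    have hs : Set.Icc P.amp₀ A ⊆ Set.Ioi 0 := fun a ha => P.amp₀_pos.trans_le ha.1
    refine ((P.continuousOn_freqDeriv.mono hs).abs).add (ContinuousOn.mul continuousOn_const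
      (ContinuousOn.mul continuousOn_const fun a ha => ?_))
    exact (Real.continuousAt_rpow_const _ _ (Or.inl (ne_of_gt (hs ha)))).continuousWithinAt
  obtain ⟨K, hK⟩ := isCompact_Icc.exists_bound_of_continuousOn hc
  refine ⟨|K| * (1 + P.β), mul_nonneg (abs_nonneg _) (by linarith [P.β_pos]), fun a ha t ht => ?_⟩
  have hK' := (le_abs_self _).trans ((hK a ha).trans (le_abs_self K))
  have h1 := one_sub_rpow_le P.β_pos ht.1.le ht.2.le
  have h2 : 0 ≤ 1 - t ^ P.β := sub_nonneg.2 (Real.rpow_le_one ht.1.le ht.2.le P.β_pos.le)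
  have h3 : 0 ≤ t ^ P.α - t ^ P.β := sub_nonneg.2
    (Real.rpow_le_rpow_of_exponent_ge ht.1 ht.2.le P.lt.le)
  have h4 : t ^ P.α ≤ 1 := Real.rpow_le_one ht.1.le ht.2.le P.α_pos.le
  have h5 : 0 ≤ P.b * (P.α * a ^ (P.α - 1)) := mul_nonneg P.b_pos.le
    (mul_nonneg P.α_pos.le (Real.rpow_nonneg (P.amp₀_pos.le.trans ha.1) _))
  calc |P.potDeriv a t|
      ≤ |P.freqDeriv a| * (1 - t ^ P.β) + P.b * (P.α * a ^ (P.α - 1)) * (t ^ P.α - t ^ P.β) := by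
        refine (abs_add_le _ _).trans_eq ?_
        rw [abs_mul, abs_of_nonneg h2, abs_of_nonneg (mul_nonneg h5 h3)]
    _ ≤ |P.freqDeriv a| * (1 - t ^ P.β) + P.b * (P.α * a ^ (P.α - 1)) * (1 - t ^ P.β) := by
        gcongr
    _ = (|P.freqDeriv a| + P.b * (P.α * a ^ (P.α - 1))) * (1 - t ^ P.β) := by ring
    _ ≤ |K| * ((1 + P.β) * (1 - t)) := mul_le_mul hK' h1 h2 (abs_nonneg _)
    _ = _ := by ring

theorem exists_abs_massIntegrandDeriv_le (A : ℝ) : ∃ C, ∀ a ∈ Set.Icc P.amp₀ A,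
    ∀ t ∈ Set.Ioo (0 : ℝ) 1, |P.massIntegrandDeriv a t| ≤ C * P.dominant t := by
  obtain ⟨K, hK0, hK⟩ := P.exists_abs_potDeriv_le A
  refine ⟨2 * A * P.potConst ^ (-(1 / 2) : ℝ) +
    A ^ 2 * (K * (1 / 2) * P.potConst ^ (-(3 / 2) : ℝ)), fun a ha t ht => ?_⟩
  have ha0 : 0 ≤ a := P.amp₀_pos.le.trans ha.1
  have hD := P.pot_pos ha.1 ht.1 ht.2
  have h1 := P.mul_pot_rpow_le ha.1 ht.1 ht.2
  have h3 := P.mul_one_sub_mul_pot_rpow_le ha.1 ht.1 ht.2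
  have n1 : 0 ≤ t * P.pot a t ^ (-(1 / 2) : ℝ) := mul_nonneg ht.1.le (Real.rpow_nonneg hD.le _)
  have n3 := Real.rpow_nonneg hD.le (-(3 / 2) : ℝ)
  have n4 : 0 ≤ 1 - t := by linarith [ht.2]
  have t1 : |2 * a * (t * P.pot a t ^ (-(1 / 2) : ℝ))| ≤
      2 * A * (P.potConst ^ (-(1 / 2) : ℝ) * P.dominant t) := by
    rw [abs_of_nonneg (mul_nonneg (by linarith) n1)]
    exact mul_le_mul (by linarith [ha.2]) h1 n1 (by linarith [ha.2])
  have t2 : |a ^ 2 * (t * (P.potDeriv a t * (-(1 / 2)) * P.pot a t ^ (-(3 / 2) : ℝ)))| ≤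
      A ^ 2 * (K * (1 / 2) * (P.potConst ^ (-(3 / 2) : ℝ) * P.dominant t)) := by
    rw [abs_mul, abs_of_nonneg (sq_nonneg a)]
    refine mul_le_mul (pow_le_pow_left₀ ha0 ha.2 2) ?_ (abs_nonneg _) (sq_nonneg _)
    rw [abs_mul, abs_mul, abs_mul, abs_of_pos ht.1, abs_of_nonneg n3]
    have e : |(-(1 / 2) : ℝ)| = 1 / 2 := by norm_num
    rw [e]
    calc t * (|P.potDeriv a t| * (1 / 2) * P.pot a t ^ (-(3 / 2) : ℝ))
        ≤ t * (K * (1 - t) * (1 / 2) * P.pot a t ^ (-(3 / 2) : ℝ)) := by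
          have := hK a ha t ht
          have := ht.1.le
          gcongr
      _ = K * (1 / 2) * (t * ((1 - t) * P.pot a t ^ (-(3 / 2) : ℝ))) := by ring
      _ ≤ _ := mul_le_mul_of_nonneg_left h3 (by linarith)
  calc |P.massIntegrandDeriv a t| ≤ _ := abs_add_le _ _
    _ ≤ _ := add_le_add t1 t2
    _ = _ := by ring

theorem hasDerivAt_massIntegrand {a t : ℝ} (ha : P.amp₀ ≤ a) (ht : t ∈ Set.Ioo (0 : ℝ) 1) :
    HasDerivAt (fun a => P.massIntegrand a t) (P.massIntegrandDeriv a t) a := by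
  have h := ((P.hasDerivAt_pot (P.amp₀_pos.trans_le ha) t).rpow_const (p := -(1 / 2))
    (Or.inl (P.pot_pos ha ht.1 ht.2).ne')).const_mul t
  have h2 := ((hasDerivAt_id a).pow 2).mul h
  refine h2.congr_deriv ?_
  rw [massIntegrandDeriv, show (-(1 / 2) - 1 : ℝ) = -(3 / 2) by norm_num]
  simp

theorem hasDerivAt_halfIntegral {a : ℝ} (ha : P.amp₀ < a) :
    HasDerivAt P.halfIntegral (P.halfIntegralDeriv a) a := by
  obtain ⟨C, hC⟩ := P.exists_abs_massIntegrandDeriv_le (a + 1)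
  refine (hasDerivAt_integral_of_dominated_loc_of_deriv_le (s := Set.Ioo P.amp₀ (a + 1))
    (Ioo_mem_nhds ha (lt_add_one a))
    (Eventually.of_forall fun x => (P.measurable_massIntegrand x).aestronglyMeasurable)
    (P.integrableOn_massIntegrand ha.le)
    (P.measurable_massIntegrandDeriv a).aestronglyMeasurable
    (bound := fun t => C * P.dominant t) ?_ (P.integrableOn_dominant.const_mul C) ?_).2
  · filter_upwards [ae_restrict_mem measurableSet_Ioo] with t ht x hx
    exact hC x ⟨hx.1.le, hx.2.le⟩ t ht
  · filter_upwards [ae_restrict_mem measurableSet_Ioo] with t ht x hx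
    exact P.hasDerivAt_massIntegrand hx.1.le ht

theorem tendsto_halfIntegralDeriv :
    Tendsto P.halfIntegralDeriv (𝓝[>] P.amp₀) (𝓝 (P.halfIntegralDeriv P.amp₀)) := by
  obtain ⟨C, hC⟩ := P.exists_abs_massIntegrandDeriv_le (P.amp₀ + 1)
  refine tendsto_integral_filter_of_dominated_convergence (fun t => C * P.dominant t)
    (Eventually.of_forall fun x => (P.measurable_massIntegrandDeriv x).aestronglyMeasurable)
    ?_ (P.integrableOn_dominant.const_mul C) ?_
  · filter_upwards [Ioo_mem_nhdsGT (lt_add_one P.amp₀)] with x hx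
    filter_upwards [ae_restrict_mem measurableSet_Ioo] with t ht
    exact hC x ⟨hx.1.le, hx.2.le⟩ t ht
  · filter_upwards [ae_restrict_mem measurableSet_Ioo] with t ht
    refine Tendsto.mono_left ?_ nhdsWithin_le_nhds
    change ContinuousAt (fun a => P.massIntegrandDeriv a t) P.amp₀
    have h0 := P.amp₀_pos
    have hpos := (P.pot_pos le_rfl ht.1 ht.2).ne'
    have c1 : ContinuousAt (fun a => P.pot a t) P.amp₀ := (P.hasDerivAt_pot h0 t).continuousAt
    have c2 : ContinuousAt P.freqDeriv P.amp₀ :=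
      P.continuousOn_freqDeriv.continuousAt (Ioi_mem_nhds h0)
    have c3 : ContinuousAt (fun a : ℝ => a ^ (P.α - 1)) P.amp₀ :=
      Real.continuousAt_rpow_const _ _ (Or.inl h0.ne')
    have c4 : ContinuousAt (fun a => P.potDeriv a t) P.amp₀ :=
      (c2.mul continuousAt_const).add
        ((continuousAt_const.mul (continuousAt_const.mul c3)).mul continuousAt_const)
    have c5 : ContinuousAt (fun a => P.pot a t ^ (-(1 / 2) : ℝ)) P.amp₀ :=
      c1.rpow_const (Or.inl hpos)
    have c6 : ContinuousAt (fun a => P.pot a t ^ (-(3 / 2) : ℝ)) P.amp₀ :=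
      c1.rpow_const (Or.inl hpos)
    exact ((continuousAt_const.mul continuousAt_id).mul (continuousAt_const.mul c5)).add
      ((continuousAt_id.pow 2).mul
        (continuousAt_const.mul ((c4.mul continuousAt_const).mul c6)))

/-! ### The limiting derivative in closed form -/

theorem pot_amp₀ (t : ℝ) : P.pot P.amp₀ t = P.b * P.amp₀ ^ P.α * (t ^ P.α - t ^ P.β) := by
  rw [pot, P.freq_amp₀, zero_mul, zero_add]

theorem amp₀_mul_potDeriv_amp₀ (t : ℝ) : P.amp₀ * P.potDeriv P.amp₀ t =
    P.b * P.amp₀ ^ P.α * ((P.β - P.α) * (1 - t ^ P.β) + P.α * (t ^ P.α - t ^ P.β)) := by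
  have h := P.mul_freqDeriv P.amp₀_pos
  rw [P.freq_amp₀] at h
  have h2 : P.amp₀ * P.amp₀ ^ (P.α - 1) = P.amp₀ ^ P.α := by
    rw [Real.rpow_sub_one P.amp₀_pos.ne']; field_simp [P.amp₀_pos.ne']
  rw [potDeriv]
  linear_combination (1 - t ^ P.β) * h + P.b * P.α * (t ^ P.α - t ^ P.β) * h2

/-- The primitive of the part of the limiting derivative which integrates to zero. -/
noncomputable def boundaryTerm (t : ℝ) : ℝ :=
  (t ^ 2 - t ^ (2 - P.α)) * P.pot P.amp₀ t ^ (-(1 / 2) : ℝ)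

noncomputable def boundaryTermDeriv (t : ℝ) : ℝ :=
  (2 * t - (2 - P.α) * t ^ (2 - P.α - 1)) * P.pot P.amp₀ t ^ (-(1 / 2) : ℝ) +
    (t ^ 2 - t ^ (2 - P.α)) * (P.b * P.amp₀ ^ P.α *
      (P.α * t ^ (P.α - 1) - P.β * t ^ (P.β - 1)) * (-(1 / 2)) *
        P.pot P.amp₀ t ^ (-(3 / 2) : ℝ))

theorem hasDerivAt_boundaryTerm {t : ℝ} (ht : t ∈ Set.Ioo (0 : ℝ) 1) :
    HasDerivAt P.boundaryTerm (P.boundaryTermDeriv t) t := by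
  have hr : ∀ s : ℝ, HasDerivAt (fun t : ℝ => t ^ s) (s * t ^ (s - 1)) t := fun s =>
    Real.hasDerivAt_rpow_const (Or.inl ht.1.ne')
  have hp : HasDerivAt (P.pot P.amp₀)
      (P.b * P.amp₀ ^ P.α * (P.α * t ^ (P.α - 1) - P.β * t ^ (P.β - 1))) t := by
    rw [show P.pot P.amp₀ = _ from funext P.pot_amp₀]
    exact ((hr _).sub (hr _)).const_mul _
  have h := (((hasDerivAt_id t).pow 2).sub (hr (2 - P.α))).mul
    (hp.rpow_const (p := -(1 / 2)) (Or.inl (P.pot_pos le_rfl ht.1 ht.2).ne'))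
  refine h.congr_deriv ?_
  rw [boundaryTermDeriv, show (-(1 / 2) - 1 : ℝ) = -(3 / 2) by norm_num]
  simp

theorem massIntegrandDeriv_amp₀ {t : ℝ} (ht : t ∈ Set.Ioo (0 : ℝ) 1) :
    P.massIntegrandDeriv P.amp₀ t = P.amp₀ * (P.boundaryTermDeriv t +
      (4 - 2 * P.α - P.β) / 2 * (t ^ (1 - P.α) * P.pot P.amp₀ t ^ (-(1 / 2) : ℝ))) := by
  have hpos := P.pot_pos le_rfl ht.1 ht.2
  have e1 : P.pot P.amp₀ t ^ (-(1 / 2) : ℝ) = P.pot P.amp₀ t * P.pot P.amp₀ t ^ (-(3 / 2) : ℝ) := by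
    rw [← Real.rpow_one_add' hpos.le (by norm_num)]; norm_num
  have h0 := P.amp₀_mul_potDeriv_amp₀ t
  have ht0 := ht.1
  have hx : 0 < t ^ P.α := Real.rpow_pos_of_pos ht0 _
  have r1 : t ^ (P.α - 1) = t ^ P.α / t := Real.rpow_sub_one ht0.ne' _
  have r2 : t ^ (P.β - 1) = t ^ P.β / t := Real.rpow_sub_one ht0.ne' _
  have r3 : t ^ (2 - P.α) = t ^ 2 / t ^ P.α := by rw [Real.rpow_sub ht0]; norm_cast
  have r4 : t ^ (2 - P.α - 1) = t / t ^ P.α := by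
    rw [show 2 - P.α - 1 = 1 - P.α by ring, Real.rpow_sub ht0, Real.rpow_one]
  have r5 : t ^ (1 - P.α) = t / t ^ P.α := by rw [Real.rpow_sub ht0, Real.rpow_one]
  have l : P.massIntegrandDeriv P.amp₀ t = P.amp₀ * (t * P.pot P.amp₀ t ^ (-(3 / 2) : ℝ)) *
      (2 * P.pot P.amp₀ t - 1 / 2 * (P.amp₀ * P.potDeriv P.amp₀ t)) := by
    rw [massIntegrandDeriv, e1]; ring
  rw [l, h0, boundaryTermDeriv, e1, r1, r2, r3, r4, r5]
  generalize P.pot P.amp₀ t ^ (-(3 / 2) : ℝ) = E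
  rw [P.pot_amp₀]
  generalize P.b * P.amp₀ ^ P.α = κ
  generalize t ^ P.β = y at *
  generalize t ^ P.α = x at *
  field_simp
  ring

theorem abs_boundaryTerm_le {t : ℝ} (ht : t ∈ Set.Ioo (0 : ℝ) 1) : |P.boundaryTerm t| ≤
    (1 + P.α) * P.potConst ^ (-(1 / 2) : ℝ) *
      (t ^ (2 - P.α * (3 / 2)) * (1 - t) ^ (1 / 2 : ℝ)) := by
  have h1 : 0 < 1 - t := by linarith [ht.2]
  have ht0 := ht.1
  have hD := P.pot_pos le_rfl ht.1 ht.2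
  have h2 := P.pot_rpow_neg_le le_rfl ht.1 ht.2 (s := 1 / 2) (by norm_num)
  have h3 := one_sub_rpow_le P.α_pos ht.1.le ht.2.le
  have h3' : 0 ≤ 1 - t ^ P.α := sub_nonneg.2 (Real.rpow_le_one ht0.le ht.2.le P.α_pos.le)
  have e0 : t ^ 2 - t ^ (2 - P.α) = -(t ^ (2 - P.α) * (1 - t ^ P.α)) := by
    have : t ^ 2 = t ^ (2 - P.α) * t ^ P.α := by
      rw [← Real.rpow_add ht0, sub_add_cancel]; norm_cast
    rw [this]; ring
  have e1 : t ^ (2 - P.α) * t ^ (-(P.α * (1 / 2))) = t ^ (2 - P.α * (3 / 2)) := by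
    rw [← Real.rpow_add ht0]; ring_nf
  have e2 : (1 - t) * (1 - t) ^ (-(1 / 2) : ℝ) = (1 - t) ^ (1 / 2 : ℝ) := by
    rw [← Real.rpow_one_add' h1.le (by norm_num)]; norm_num
  have n1 := Real.rpow_nonneg ht0.le (2 - P.α)
  rw [boundaryTerm, e0, abs_mul, abs_neg, abs_of_nonneg (mul_nonneg n1 h3'),
    abs_of_nonneg (Real.rpow_nonneg hD.le _)]
  calc t ^ (2 - P.α) * (1 - t ^ P.α) * P.pot P.amp₀ t ^ (-(1 / 2) : ℝ)
      ≤ t ^ (2 - P.α) * ((1 + P.α) * (1 - t)) * (P.potConst ^ (-(1 / 2) : ℝ) *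
          (t ^ (-(P.α * (1 / 2))) * (1 - t) ^ (-(1 / 2) : ℝ))) := by
        have := P.α_pos
        exact mul_le_mul (mul_le_mul_of_nonneg_left h3 n1) h2 (Real.rpow_nonneg hD.le _)
          (by positivity)
    _ = (1 + P.α) * P.potConst ^ (-(1 / 2) : ℝ) * ((t ^ (2 - P.α) * t ^ (-(P.α * (1 / 2)))) *
          ((1 - t) * (1 - t) ^ (-(1 / 2) : ℝ))) := by ring
    _ = _ := by rw [e1, e2]

theorem tendsto_boundaryTerm {x : ℝ} (hx : x = 0 ∨ x = 1) :
    Tendsto P.boundaryTerm (𝓝[Set.Ioo 0 1] x) (𝓝 0) := by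
  have hα : 0 < 2 - P.α * (3 / 2) := by linarith [P.α_lt]
  have hc : Continuous fun t : ℝ => (1 + P.α) * P.potConst ^ (-(1 / 2) : ℝ) *
      (t ^ (2 - P.α * (3 / 2)) * (1 - t) ^ (1 / 2 : ℝ)) := by
    have h1 := Real.continuous_rpow_const hα.le
    have h2 := (Real.continuous_rpow_const (q := 1 / 2) (by norm_num)).comp
      (continuous_const.sub continuous_id : Continuous fun t : ℝ => 1 - t)
    exact continuous_const.mul (h1.mul h2)
  have h0 : (1 + P.α) * P.potConst ^ (-(1 / 2) : ℝ) *
      (x ^ (2 - P.α * (3 / 2)) * (1 - x) ^ (1 / 2 : ℝ)) = 0 := by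
    rcases hx with rfl | rfl
    · rw [Real.zero_rpow hα.ne']; ring
    · rw [sub_self, Real.zero_rpow (by norm_num)]; ring
  have ht := hc.tendsto x
  rw [h0] at ht
  refine squeeze_zero_norm' ?_ (ht.mono_left nhdsWithin_le_nhds)
  filter_upwards [self_mem_nhdsWithin] with t ht using P.abs_boundaryTerm_le ht

theorem integrableOn_rpow_mul_pot : IntegrableOn
    (fun t => t ^ (1 - P.α) * P.pot P.amp₀ t ^ (-(1 / 2) : ℝ)) (Set.Ioo 0 1) := by
  refine Integrable.mono' (P.integrableOn_dominant.const_mul (P.potConst ^ (-(1 / 2) : ℝ)))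
    ((measurable_id.pow_const _).mul
      ((P.continuous_pot _).measurable.pow_const _)).aestronglyMeasurable ?_
  filter_upwards [ae_restrict_mem measurableSet_Ioo] with t ht
  have h1 := P.pot_rpow_neg_le le_rfl ht.1 ht.2 (s := 1 / 2) (by norm_num)
  have n1 := Real.rpow_nonneg ht.1.le (1 - P.α)
  have e1 : t ^ (1 - P.α) * t ^ (-(P.α * (1 / 2))) = t ^ (1 - P.α * (3 / 2)) := by
    rw [← Real.rpow_add ht.1]; ring_nf
  rw [Real.norm_of_nonneg (mul_nonneg n1 (Real.rpow_nonneg (P.pot_pos le_rfl ht.1 ht.2).le _))]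
  calc _ ≤ t ^ (1 - P.α) * (P.potConst ^ (-(1 / 2) : ℝ) *
          (t ^ (-(P.α * (1 / 2))) * (1 - t) ^ (-(1 / 2) : ℝ))) :=
        mul_le_mul_of_nonneg_left h1 n1
    _ = P.potConst ^ (-(1 / 2) : ℝ) * ((t ^ (1 - P.α) * t ^ (-(P.α * (1 / 2)))) *
          (1 - t) ^ (-(1 / 2) : ℝ)) := by ring
    _ = _ := by rw [e1, dominant]

theorem integrableOn_massIntegrandDeriv_amp₀ :
    IntegrableOn (P.massIntegrandDeriv P.amp₀) (Set.Ioo 0 1) := by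
  obtain ⟨C, hC⟩ := P.exists_abs_massIntegrandDeriv_le P.amp₀
  refine Integrable.mono' (P.integrableOn_dominant.const_mul C)
    (P.measurable_massIntegrandDeriv _).aestronglyMeasurable ?_
  filter_upwards [ae_restrict_mem measurableSet_Ioo] with t ht
  exact hC _ ⟨le_rfl, le_rfl⟩ t ht

theorem halfIntegralDeriv_amp₀ : P.halfIntegralDeriv P.amp₀ =
    P.amp₀ * ((4 - 2 * P.α - P.β) / 2 *
      ∫ t in Set.Ioo 0 1, t ^ (1 - P.α) * P.pot P.amp₀ t ^ (-(1 / 2) : ℝ)) := by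
  have hI := P.integrableOn_rpow_mul_pot.const_mul ((4 - 2 * P.α - P.β) / 2)
  have hB : IntegrableOn P.boundaryTermDeriv (Set.Ioo 0 1) := by
    refine IntegrableOn.congr_fun
      ((P.integrableOn_massIntegrandDeriv_amp₀.const_mul P.amp₀⁻¹).sub hI) (fun t ht => ?_)
      measurableSet_Ioo
    have := P.amp₀_pos.ne'
    simp only [Pi.sub_apply, P.massIntegrandDeriv_amp₀ ht]
    field_simp
    ring
  have h0 : ∫ t in Set.Ioo 0 1, P.boundaryTermDeriv t = 0 := by
    rw [← integral_Ioc_eq_integral_Ioo, ← intervalIntegral.integral_of_le zero_le_one,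
      intervalIntegral.integral_eq_sub_of_hasDerivAt_of_tendsto zero_lt_one
        (fun t ht => P.hasDerivAt_boundaryTerm ht)
        ((intervalIntegrable_iff_integrableOn_Ioo_of_le zero_le_one).2 hB)
        (fa := 0) (fb := 0), sub_zero]
    · rw [← nhdsWithin_Ioo_eq_nhdsGT zero_lt_one]; exact P.tendsto_boundaryTerm (Or.inl rfl)
    · rw [← nhdsWithin_Ioo_eq_nhdsLT zero_lt_one]; exact P.tendsto_boundaryTerm (Or.inr rfl)
  rw [halfIntegralDeriv, setIntegral_congr_fun measurableSet_Ioo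
    (fun t ht => P.massIntegrandDeriv_amp₀ ht), integral_const_mul, integral_add hB hI, h0,
    integral_const_mul, zero_add]

theorem integral_rpow_mul_pot_pos :
    0 < ∫ t in Set.Ioo 0 1, t ^ (1 - P.α) * P.pot P.amp₀ t ^ (-(1 / 2) : ℝ) := by
  rw [← integral_Ioc_eq_integral_Ioo, ← intervalIntegral.integral_of_le zero_le_one]
  refine intervalIntegral.intervalIntegral_pos_of_pos_on
    ((intervalIntegrable_iff_integrableOn_Ioo_of_le zero_le_one).2 P.integrableOn_rpow_mul_pot)
    (fun t ht => ?_) zero_lt_one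
  exact mul_pos (Real.rpow_pos_of_pos ht.1 _)
    (Real.rpow_pos_of_pos (P.pot_pos le_rfl ht.1 ht.2) _)

end PowerPair

namespace PowerPair

variable (P : PowerPair)

/-! ### The mass of an arbitrary profile -/

theorem integral_Ioi_sq_eq {a x₀ : ℝ} (ha : P.amp₀ ≤ a) {f f' : ℝ → ℝ}
    (hf : ∀ x, HasDerivAt f (f' x) x) (hpos : ∀ x, 0 < f x) (hx₀ : f x₀ = a)
    (hlim : Tendsto f atTop (𝓝 0)) (hen : ∀ x, f' x ^ 2 = f x ^ 2 * P.pot a (f x / a))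
    (hne : ∀ x, x₀ < x → f' x ≠ 0) :
    ∫ x in Set.Ioi x₀, f x ^ 2 = P.halfIntegral a := by
  have ha0 : 0 < a := P.amp₀_pos.trans_le ha
  have hcont : Continuous f := continuous_iff_continuousAt.2 fun x => (hf x).continuousAt
  have hlt : ∃ x, x₀ < x ∧ f x < a := by
    obtain ⟨x, h1, h2⟩ := ((hlim.eventually_lt_const ha0).and (eventually_gt_atTop x₀)).exists
    exact ⟨x, h2, h1⟩
  have hneg : ∀ x ∈ Set.Ioi x₀, f' x < 0 := by
    rcases hasDerivWithinAt_forall_lt_or_forall_gt_of_forall_ne (convex_Ioi x₀)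
      (fun x _ => (hf x).hasDerivWithinAt) hne with h | h
    · exact h
    · obtain ⟨x, hx, hxa⟩ := hlt
      have hm : StrictMonoOn f (Set.Ici x₀) := strictMonoOn_of_deriv_pos (convex_Ici x₀)
        hcont.continuousOn (fun y hy => by rw [interior_Ici] at hy; rw [(hf y).deriv]; exact h y hy)
      have := hm Set.self_mem_Ici hx.le hx
      linarith
  have hanti : StrictAntiOn f (Set.Ici x₀) := strictAntiOn_of_deriv_neg (convex_Ici x₀)
    hcont.continuousOn (fun y hy => by rw [interior_Ici] at hy; rw [(hf y).deriv]; exact hneg y hy)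
  have himg : (fun x => f x / a) '' Set.Ioi x₀ = Set.Ioo 0 1 := by
    ext t
    constructor
    · rintro ⟨x, hx, rfl⟩
      refine ⟨div_pos (hpos x) ha0, (div_lt_one ha0).2 ?_⟩
      rw [← hx₀]
      exact hanti Set.self_mem_Ici (Set.Ioi_subset_Ici_self hx) hx
    · rintro ⟨h1, h2⟩
      have hta : 0 < t * a := mul_pos h1 ha0
      obtain ⟨X, h3, h4⟩ :=
        ((hlim.eventually_lt_const hta).and (eventually_gt_atTop x₀)).exists
      obtain ⟨x, hx, he⟩ := intermediate_value_Ioo' (le_of_lt h4) hcont.continuousOn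
        (show t * a ∈ Set.Ioo (f X) (f x₀) from ⟨h3, by rw [hx₀]; nlinarith⟩)
      exact ⟨x, hx.1, by simp only [he]; field_simp⟩
  have hinj : Set.InjOn (fun x => f x / a) (Set.Ioi x₀) := fun x hx y hy hxy =>
    hanti.injOn (Set.Ioi_subset_Ici_self hx) (Set.Ioi_subset_Ici_self hy) ((div_left_inj' ha0.ne').1 hxy)
  rw [halfIntegral, ← himg, integral_image_eq_integral_abs_deriv_smul measurableSet_Ioi
    (fun x _ => ((hf x).div_const a).hasDerivWithinAt) hinj]
  refine setIntegral_congr_fun measurableSet_Ioi fun x hx => ?_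
  have hD : 0 < P.pot a (f x / a) := by
    refine pos_of_mul_pos_right (a := f x ^ 2) ?_ (sq_nonneg _)
    rw [← hen]
    have := hne x hx
    positivity
  have habs : |f' x| = f x * P.pot a (f x / a) ^ (1 / 2 : ℝ) := by
    rw [← Real.sqrt_eq_rpow, ← Real.sqrt_sq_eq_abs, hen, Real.sqrt_mul (sq_nonneg _),
      Real.sqrt_sq (hpos x).le]
  have e : P.pot a (f x / a) ^ (1 / 2 : ℝ) * P.pot a (f x / a) ^ (-(1 / 2) : ℝ) = 1 := by
    rw [← Real.rpow_add hD]; norm_num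
  simp only [massIntegrand, smul_eq_mul]
  rw [abs_div, abs_of_pos ha0, habs]
  have : f x / a * P.pot a (f x / a) ^ (1 / 2 : ℝ) *
      (a ^ 2 * (f x / a * P.pot a (f x / a) ^ (-(1 / 2) : ℝ))) =
      f x ^ 2 * (P.pot a (f x / a) ^ (1 / 2 : ℝ) * P.pot a (f x / a) ^ (-(1 / 2) : ℝ)) := by
    field_simp
  rw [mul_div_right_comm, this, e, mul_one]

variable {P} {ω : ℝ} {φ : ℝ → ℝ}

theorem hasDerivAt_profile (h : IsStandingWaveProfile (P.α + 1) (P.β + 1) ω φ) (x : ℝ) :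
    HasDerivAt φ (deriv φ x) x :=
  ((h.contDiff.differentiable (by norm_num)) x).hasDerivAt

theorem hasDerivAt_deriv_profile (h : IsStandingWaveProfile (P.α + 1) (P.β + 1) ω φ) (x : ℝ) :
    HasDerivAt (deriv φ) (φ x * (ω + φ x ^ P.α - φ x ^ P.β)) x := by
  have h1 : ContDiff ℝ (1 + 1) φ := by rw [one_add_one_eq_two]; exact h.contDiff
  have h2 : ContDiff ℝ 1 (deriv φ) := (contDiff_succ_iff_deriv.1 h1).2.2
  have h3 := ((h2.differentiable (by norm_num)) x).hasDerivAt
  refine h3.congr_deriv ?_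
  have := h.equation x
  rw [add_sub_cancel_right, add_sub_cancel_right, abs_of_pos (h.pos x)] at this
  linarith

theorem tendsto_profile (h : IsStandingWaveProfile (P.α + 1) (P.β + 1) ω φ) :
    Tendsto φ atTop (𝓝 0) ∧ Tendsto φ atBot (𝓝 0) := by
  have hd : ∀ x, HasDerivAt (fun x => φ x ^ 2) (2 * (φ x * deriv φ x)) x := fun x => by
    refine ((hasDerivAt_profile h x).pow 2).congr_deriv ?_
    simp; ring
  have hi : Integrable fun x => φ x ^ 2 := h.memLp.integrable_sq
  have hi' : Integrable fun x => 2 * (φ x * deriv φ x) :=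
    (h.memLp.integrable_mul h.memLp_deriv).const_mul 2
  have key : ∀ l : Filter ℝ, Tendsto (fun x => φ x ^ 2) l (𝓝 0) → Tendsto φ l (𝓝 0) := by
    intro l hl
    have := hl.sqrt
    rw [Real.sqrt_zero] at this
    exact this.congr fun x => Real.sqrt_sq (h.pos x).le
  exact ⟨key _ (tendsto_zero_of_hasDerivAt_of_integrableOn_Ioi (a := 0) (fun x _ => hd x)
    hi'.integrableOn hi.integrableOn),
    key _ (tendsto_zero_of_hasDerivAt_of_integrableOn_Iic (a := 0) (fun x _ => hd x)
    hi'.integrableOn hi.integrableOn)⟩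

theorem exists_isMax_profile (h : IsStandingWaveProfile (P.α + 1) (P.β + 1) ω φ) :
    ∃ x₀, ∀ x, φ x ≤ φ x₀ := by
  refine h.contDiff.continuous.exists_forall_ge' 0 ?_
  rw [cocompact_eq_atBot_atTop, eventually_sup]
  exact ⟨((tendsto_profile h).2.eventually_lt_const (h.pos 0)).mono fun _ h => h.le,
    ((tendsto_profile h).1.eventually_lt_const (h.pos 0)).mono fun _ h => h.le⟩

theorem deriv_profile_sq (h : IsStandingWaveProfile (P.α + 1) (P.β + 1) ω φ) (x : ℝ) :
    deriv φ x ^ 2 = φ x ^ 2 * (ω + P.b * φ x ^ P.α - P.c * φ x ^ P.β) := by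
  set E : ℝ → ℝ := fun x =>
    deriv φ x ^ 2 - φ x ^ 2 * (ω + P.b * φ x ^ P.α - P.c * φ x ^ P.β) with hE
  have hb : P.b * (P.α + 2) = 2 := div_mul_cancel₀ _ (by linarith [P.α_pos])
  have hc : P.c * (P.β + 2) = 2 := div_mul_cancel₀ _ (by linarith [P.β_pos])
  have hd : ∀ x, HasDerivAt E 0 x := fun x => by
    have h1 := hasDerivAt_profile h x
    have h2 := hasDerivAt_deriv_profile h x
    have hp := h.pos x
    have h3 := (h2.pow 2).sub ((h1.pow 2).mul
      (((h1.rpow_const (p := P.α) (Or.inl hp.ne')).const_mul P.b).const_add ω |>.sub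
        ((h1.rpow_const (p := P.β) (Or.inl hp.ne')).const_mul P.c)))
    refine h3.congr_deriv ?_
    rw [Real.rpow_sub_one hp.ne', Real.rpow_sub_one hp.ne']
    simp only [Nat.cast_ofNat, Nat.add_one_sub_one, pow_one, Pi.sub_apply, Pi.pow_apply]
    field_simp
    linear_combination
      (-(deriv φ x * φ x * φ x ^ P.α)) * hb + deriv φ x * φ x * φ x ^ P.β * hc
  have hconst : ∀ y, E y = E x := fun y =>
    is_const_of_deriv_eq_zero (fun z => (hd z).differentiableAt) (fun z => (hd z).deriv) y x
  obtain ⟨x₀, hx₀⟩ := exists_isMax_profile h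
  have hcont := h.contDiff.continuous
  have hi : Integrable E := by
    refine h.memLp_deriv.integrable_sq.sub ?_
    refine (h.memLp.integrable_sq.mul_bdd (c := |ω| + P.b * φ x₀ ^ P.α + P.c * φ x₀ ^ P.β)
      ?_ ?_)
    · have h1 := hcont.rpow_const (p := P.α) fun y => Or.inl (h.pos y).ne'
      have h2 := hcont.rpow_const (p := P.β) fun y => Or.inl (h.pos y).ne'
      exact ((continuous_const.add (continuous_const.mul h1)).sub
        (continuous_const.mul h2)).aestronglyMeasurable
    · refine Eventually.of_forall fun y => ?_
      have h1 := Real.rpow_le_rpow (h.pos y).le (hx₀ y) P.α_pos.le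
      have h2 := Real.rpow_le_rpow (h.pos y).le (hx₀ y) P.β_pos.le
      have n1 := Real.rpow_nonneg (h.pos y).le P.α
      have n2 := Real.rpow_nonneg (h.pos y).le P.β
      have hb := P.b_pos
      have hc := P.c_pos
      rw [Real.norm_eq_abs]
      refine (abs_sub _ _).trans (add_le_add ((abs_add_le _ _).trans (add_le_add le_rfl ?_)) ?_)
      · rw [abs_of_nonneg (by positivity)]; gcongr
      · rw [abs_of_nonneg (by positivity)]; gcongr
  have hi' : Integrable fun _ : ℝ => E x := by
    convert hi using 1
    ext y
    exact (hconst y).symm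
  rcases integrable_const_iff.1 hi' with h0 | h0
  · simp only [hE] at h0
    linarith
  · exact absurd h0.measure_univ_lt_top (by simp)

theorem deriv_profile_sq_eq_pot (hω : 0 < ω)
    (h : IsStandingWaveProfile (P.α + 1) (P.β + 1) ω φ) (x : ℝ) :
    deriv φ x ^ 2 = φ x ^ 2 * P.pot (P.amp ω) (φ x / P.amp ω) := by
  have ha := P.amp₀_pos.trans (P.amp_gt hω)
  rw [P.pot_eq ha (div_pos (h.pos x) ha).le, P.freq_amp hω, mul_div_cancel₀ _ ha.ne',
    deriv_profile_sq h]

theorem profile_le_amp (hω : 0 < ω) (h : IsStandingWaveProfile (P.α + 1) (P.β + 1) ω φ) (x : ℝ) :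
    φ x ≤ P.amp ω := by
  have ha := P.amp₀_pos.trans (P.amp_gt hω)
  by_contra hlt
  have h1 := P.pot_neg (P.amp_gt hω).le ((one_lt_div ha).2 (not_le.1 hlt))
  have h2 := deriv_profile_sq_eq_pot hω h x
  nlinarith [sq_nonneg (deriv φ x), pow_pos (h.pos x) 2]

theorem profile_eq_amp_of_deriv_eq_zero (hω : 0 < ω)
    (h : IsStandingWaveProfile (P.α + 1) (P.β + 1) ω φ) {x : ℝ} (hx : deriv φ x = 0) :
    φ x = P.amp ω := by
  have ha := P.amp₀_pos.trans (P.amp_gt hω)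
  refine (profile_le_amp hω h x).eq_or_lt.resolve_right fun hlt => ?_
  have h1 := P.pot_pos (P.amp_gt hω).le (div_pos (h.pos x) ha) ((div_lt_one ha).2 hlt)
  have h2 := deriv_profile_sq_eq_pot hω h x
  rw [hx] at h2
  nlinarith [pow_pos (h.pos x) 2]

theorem accel_amp_neg (hω : 0 < ω) :
    P.amp ω * (ω + P.amp ω ^ P.α - P.amp ω ^ P.β) < 0 := by
  have ha := P.amp₀_pos.trans (P.amp_gt hω)
  refine mul_neg_of_pos_of_neg ha ?_
  have hb : P.b * (P.α + 2) = 2 := div_mul_cancel₀ _ (by linarith [P.α_pos])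
  have hc : P.c * (P.β + 2) = 2 := div_mul_cancel₀ _ (by linarith [P.β_pos])
  have h1 := mul_pos ha (P.freqDeriv_pos (P.amp_gt hω).le)
  have h2 := P.freq_amp hω
  rw [P.mul_freqDeriv ha] at h1
  rw [h2] at h1
  rw [freq] at h2
  have h3 : 2 * (ω + P.amp ω ^ P.α - P.amp ω ^ P.β) =
      -(P.β * ω + (P.β - P.α) * (P.b * P.amp ω ^ P.α)) := by
    linear_combination (-P.amp ω ^ P.α) * hb + P.amp ω ^ P.β * hc - (P.β + 2) * h2
  linarith

theorem deriv_profile_ne_zero (hω : 0 < ω)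
    (h : IsStandingWaveProfile (P.α + 1) (P.β + 1) ω φ) {x y : ℝ} (hxy : x < y)
    (hx : deriv φ x = 0) : deriv φ y ≠ 0 := by
  intro hy
  have hcont := h.contDiff.continuous
  obtain ⟨z, hz, hmin⟩ := isCompact_Icc.exists_isMinOn (Set.nonempty_Icc.2 hxy.le)
    hcont.continuousOn
  have hza : φ z = P.amp ω := by
    refine profile_eq_amp_of_deriv_eq_zero hω h ?_
    rcases hz.1.eq_or_lt with rfl | h1
    · exact hx
    rcases hz.2.eq_or_lt with rfl | h2
    · exact hy
    exact (hmin.isLocalMin (Icc_mem_nhds h1 h2)).deriv_eq_zero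
  have hconst : ∀ t ∈ Set.Icc x y, φ t = P.amp ω := fun t ht =>
    le_antisymm (profile_le_amp hω h t) (hza ▸ hmin ht)
  obtain ⟨m, hm⟩ := exists_between hxy
  have hd : deriv φ =ᶠ[𝓝 m] fun _ => 0 := by
    filter_upwards [Ioo_mem_nhds hm.1 hm.2] with t ht
    have : φ =ᶠ[𝓝 t] fun _ => P.amp ω := by
      filter_upwards [Icc_mem_nhds ht.1 ht.2] with s hs using hconst s hs
    rw [this.deriv_eq, deriv_const]
  have h1 := (hasDerivAt_deriv_profile h m).deriv
  rw [hd.deriv_eq, deriv_const, hconst m ⟨hm.1.le, hm.2.le⟩] at h1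
  exact (P.accel_amp_neg hω).ne h1.symm

theorem integral_profile_sq (hω : 0 < ω)
    (h : IsStandingWaveProfile (P.α + 1) (P.β + 1) ω φ) :
    ∫ x, φ x ^ 2 = 2 * P.halfIntegral (P.amp ω) := by
  obtain ⟨x₀, hmax⟩ := exists_isMax_profile h
  have hx₀ : deriv φ x₀ = 0 := IsLocalMax.deriv_eq_zero (Eventually.of_forall hmax)
  have ha : φ x₀ = P.amp ω := profile_eq_amp_of_deriv_eq_zero hω h hx₀
  have hr : ∫ x in Set.Ioi x₀, φ x ^ 2 = P.halfIntegral (P.amp ω) :=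
    P.integral_Ioi_sq_eq (P.amp_gt hω).le (hasDerivAt_profile h) h.pos ha (tendsto_profile h).1
      (deriv_profile_sq_eq_pot hω h) fun x hx => deriv_profile_ne_zero hω h hx hx₀
  have hl : ∫ x in Set.Ioi (-x₀), φ (-x) ^ 2 = P.halfIntegral (P.amp ω) := by
    refine P.integral_Ioi_sq_eq (f' := fun x => -deriv φ (-x)) (P.amp_gt hω).le (fun x => ?_)
      (fun x => h.pos _) (by rw [neg_neg, ha]) ((tendsto_profile h).2.comp tendsto_neg_atTop_atBot)
      (fun x => by rw [neg_sq]; exact deriv_profile_sq_eq_pot hω h _) fun x hx => ?_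
    · refine ((hasDerivAt_profile h (-x)).scomp x (hasDerivAt_neg x)).congr_deriv ?_
      simp
    · intro h0
      exact deriv_profile_ne_zero hω h (neg_lt.1 hx) (neg_eq_zero.1 h0) hx₀
  rw [integral_comp_neg_Ioi (-x₀) fun x => φ x ^ 2, neg_neg] at hl
  rw [← intervalIntegral.integral_Iic_add_Ioi h.memLp.integrable_sq.integrableOn
    h.memLp.integrable_sq.integrableOn (b := x₀), hl, hr]
  ring

end PowerPair

namespace PowerPair

variable (P : PowerPair) {a : ℝ}

/-! ### Existence of profiles by quadrature -/

/-- The derivative of the position with respect to `η`, where the profile is `a * exp (-|η|)`. -/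
noncomputable def timeDensity (a η : ℝ) : ℝ := P.pot a (Real.exp (-|η|)) ^ (-(1 / 2) : ℝ)

noncomputable def time (a y : ℝ) : ℝ := ∫ η in (0 : ℝ)..y, P.timeDensity a η

theorem pot_le {t : ℝ} (ha : P.amp₀ ≤ a) (ht : 0 ≤ t) (ht1 : t ≤ 1) :
    P.pot a t ≤ P.freq a + P.b * a ^ P.α := by
  have h1 := Real.rpow_nonneg ht P.β
  have h2 : t ^ P.α ≤ 1 := Real.rpow_le_one ht ht1 P.α_pos.le
  have h3 := P.freq_nonneg ha
  have h4 := mul_pos P.b_pos (Real.rpow_pos_of_pos (P.amp₀_pos.trans_le ha) P.α)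
  unfold pot
  nlinarith

theorem exp_neg_abs_lt_one {η : ℝ} (h : η ≠ 0) : Real.exp (-|η|) < 1 :=
  Real.exp_lt_one_iff.mpr (neg_neg_of_pos (abs_pos.2 h))

theorem pot_exp_pos (ha : P.amp₀ ≤ a) {η : ℝ} (h : η ≠ 0) : 0 < P.pot a (Real.exp (-|η|)) :=
  P.pot_pos ha (Real.exp_pos _) (exp_neg_abs_lt_one h)

theorem pot_exp_nonneg (ha : P.amp₀ ≤ a) (η : ℝ) : 0 ≤ P.pot a (Real.exp (-|η|)) := by
  by_cases h : η = 0
  · simp [h, pot_one]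
  · exact (P.pot_exp_pos ha h).le

theorem timeDensity_pos (ha : P.amp₀ ≤ a) {η : ℝ} (h : η ≠ 0) : 0 < P.timeDensity a η :=
  Real.rpow_pos_of_pos (P.pot_exp_pos ha h) _

theorem le_timeDensity (ha : P.amp₀ ≤ a) {η : ℝ} (h : η ≠ 0) :
    (P.freq a + P.b * a ^ P.α) ^ (-(1 / 2) : ℝ) ≤ P.timeDensity a η :=
  Real.rpow_le_rpow_of_nonpos (P.pot_exp_pos ha h)
    (P.pot_le ha (Real.exp_pos _).le (exp_neg_abs_lt_one h).le) (by norm_num)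

theorem timeDensity_neg (η : ℝ) : P.timeDensity a (-η) = P.timeDensity a η := by
  rw [timeDensity, timeDensity, abs_neg]

theorem measurable_timeDensity : Measurable (P.timeDensity a) :=
  ((P.continuous_pot a).comp (Real.continuous_exp.comp continuous_abs.neg)).measurable.pow_const _

theorem continuousAt_timeDensity (ha : P.amp₀ ≤ a) {η : ℝ} (h : η ≠ 0) :
    ContinuousAt (P.timeDensity a) η :=
  ((P.continuous_pot a).comp (Real.continuous_exp.comp continuous_abs.neg)).continuousAt.rpow_const
    (Or.inl (P.pot_exp_pos ha h).ne')

theorem timeDensity_le (ha : P.amp₀ ≤ a) {η : ℝ} (h : 0 < η) : P.timeDensity a η ≤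
    P.potConst ^ (-(1 / 2) : ℝ) * Real.exp ((P.α + 1) / 2 * η) * η ^ (-(1 / 2) : ℝ) := by
  have h1 := P.pot_rpow_neg_le ha (Real.exp_pos (-|η|)) (exp_neg_abs_lt_one h.ne')
    (s := 1 / 2) (by norm_num)
  rw [abs_of_pos h, ← Real.exp_mul] at h1
  have h2 : η * Real.exp (-η) ≤ 1 - Real.exp (-η) := by
    have h3 := Real.add_one_le_exp η
    have h4 : Real.exp η * Real.exp (-η) = 1 := by rw [← Real.exp_add]; simp
    nlinarith [Real.exp_pos (-η)]
  have h3 := Real.rpow_le_rpow_of_nonpos (mul_pos h (Real.exp_pos (-η))) h2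
    (show (-(1 / 2) : ℝ) ≤ 0 by norm_num)
  rw [Real.mul_rpow h.le (Real.exp_pos _).le, ← Real.exp_mul] at h3
  have hK := Real.rpow_nonneg P.potConst_pos.le (-(1 / 2) : ℝ)
  rw [timeDensity, abs_of_pos h]
  refine h1.trans ?_
  calc _ ≤ P.potConst ^ (-(1 / 2) : ℝ) * (Real.exp (-η * -(P.α * (1 / 2))) *
          (η ^ (-(1 / 2) : ℝ) * Real.exp (-η * -(1 / 2)))) := by gcongr
    _ = P.potConst ^ (-(1 / 2) : ℝ) * (Real.exp (-η * -(P.α * (1 / 2))) *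
          Real.exp (-η * -(1 / 2))) * η ^ (-(1 / 2) : ℝ) := by ring
    _ = _ := by rw [← Real.exp_add]; ring_nf

theorem intervalIntegrable_timeDensity (ha : P.amp₀ ≤ a) (x y : ℝ) :
    IntervalIntegrable (P.timeDensity a) volume x y := by
  have hpos : ∀ z, 0 ≤ z → IntervalIntegrable (P.timeDensity a) volume 0 z := by
    intro z hz
    have hd : IntervalIntegrable (fun η : ℝ =>
        P.potConst ^ (-(1 / 2) : ℝ) * Real.exp ((P.α + 1) / 2 * η) * η ^ (-(1 / 2) : ℝ))
        volume 0 z :=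
      (intervalIntegral.intervalIntegrable_rpow' (by norm_num)).continuousOn_mul
        (by fun_prop)
    rw [intervalIntegrable_iff_integrableOn_Ioc_of_le hz] at hd ⊢
    refine Integrable.mono' hd P.measurable_timeDensity.aestronglyMeasurable ?_
    filter_upwards [ae_restrict_mem measurableSet_Ioc] with η hη
    rw [Real.norm_of_nonneg (P.timeDensity_pos ha hη.1.ne').le]
    exact P.timeDensity_le ha hη.1
  have hall : ∀ z, IntervalIntegrable (P.timeDensity a) volume 0 z := by
    intro z
    rcases le_total 0 z with hz | hz
    · exact hpos z hz
    · have h := (hpos (-z) (neg_nonneg.2 hz)).comp_sub_left 0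
      simpa [P.timeDensity_neg] using h
  exact (hall x).symm.trans (hall y)

theorem mul_sub_le_time_sub (ha : P.amp₀ ≤ a) {x y : ℝ} (hxy : x ≤ y) :
    (P.freq a + P.b * a ^ P.α) ^ (-(1 / 2) : ℝ) * (y - x) ≤ P.time a y - P.time a x := by
  rw [time, time, intervalIntegral.integral_interval_sub_left
    (P.intervalIntegrable_timeDensity ha _ _) (P.intervalIntegrable_timeDensity ha _ _)]
  have h := intervalIntegral.integral_mono_ae (μ := volume) hxy
    (intervalIntegrable_const (c := (P.freq a + P.b * a ^ P.α) ^ (-(1 / 2) : ℝ)))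
    (P.intervalIntegrable_timeDensity ha x y) (by
      filter_upwards [compl_mem_ae_iff.2 (measure_singleton (0 : ℝ))] with η hη
      exact P.le_timeDensity ha hη)
  rwa [intervalIntegral.integral_const, smul_eq_mul, mul_comm] at h

theorem timeRate_pos (ha : P.amp₀ ≤ a) : 0 < (P.freq a + P.b * a ^ P.α) ^ (-(1 / 2) : ℝ) :=
  Real.rpow_pos_of_pos (add_pos_of_nonneg_of_pos (P.freq_nonneg ha)
    (mul_pos P.b_pos (Real.rpow_pos_of_pos (P.amp₀_pos.trans_le ha) _))) _

theorem strictMono_time (ha : P.amp₀ ≤ a) : StrictMono (P.time a) := fun x y hxy => by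
  have h1 := P.mul_sub_le_time_sub ha hxy.le
  have h2 := mul_pos (P.timeRate_pos ha) (sub_pos.2 hxy)
  linarith

theorem time_zero : P.time a 0 = 0 := intervalIntegral.integral_same

theorem surjective_time (ha : P.amp₀ ≤ a) : Function.Surjective (P.time a) := by
  have hr := P.timeRate_pos ha
  refine (intervalIntegral.continuous_primitive
    (P.intervalIntegrable_timeDensity ha) 0).surjective ?_ ?_
  · refine tendsto_atTop_mono' _ ?_ (tendsto_id.const_mul_atTop hr)
    filter_upwards [eventually_ge_atTop 0] with y hy
    have := P.mul_sub_le_time_sub ha hy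
    rwa [P.time_zero, sub_zero, sub_zero] at this
  · refine tendsto_atBot_mono' _ ?_ (tendsto_id.const_mul_atBot hr)
    filter_upwards [eventually_le_atBot 0] with y hy
    have := P.mul_sub_le_time_sub ha hy
    rw [P.time_zero] at this
    change P.time a y ≤ _ * y
    linarith

/-- Minus the logarithm of the normalised profile, with the sign of the position. -/
noncomputable def logProfile (ha : P.amp₀ ≤ a) : ℝ ≃o ℝ :=
  ((P.strictMono_time ha).orderIsoOfSurjective _ (P.surjective_time ha)).symm

theorem time_logProfile (ha : P.amp₀ ≤ a) (x : ℝ) : P.time a (P.logProfile ha x) = x :=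
  ((P.strictMono_time ha).orderIsoOfSurjective _ (P.surjective_time ha)).apply_symm_apply x

theorem logProfile_zero (ha : P.amp₀ ≤ a) : P.logProfile ha 0 = 0 :=
  (P.strictMono_time ha).injective (by rw [P.time_logProfile, P.time_zero])

theorem logProfile_ne_zero (ha : P.amp₀ ≤ a) {x : ℝ} (hx : x ≠ 0) : P.logProfile ha x ≠ 0 := by
  rw [← P.logProfile_zero ha]
  exact (P.logProfile ha).injective.ne hx

theorem hasDerivAt_logProfile (ha : P.amp₀ ≤ a) {x : ℝ} (hx : x ≠ 0) :
    HasDerivAt (P.logProfile ha)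
      (P.pot a (Real.exp (-|P.logProfile ha x|)) ^ (1 / 2 : ℝ)) x := by
  have hne := P.logProfile_ne_zero ha hx
  have h1 : HasDerivAt (P.time a) (P.timeDensity a (P.logProfile ha x)) (P.logProfile ha x) :=
    intervalIntegral.integral_hasDerivAt_right (P.intervalIntegrable_timeDensity ha _ _)
      P.measurable_timeDensity.stronglyMeasurable.stronglyMeasurableAtFilter
      (P.continuousAt_timeDensity ha hne)
  have h2 := HasDerivAt.of_local_left_inverse (P.logProfile ha).continuous.continuousAt h1
    (P.timeDensity_pos ha hne).ne' (Eventually.of_forall (P.time_logProfile ha))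
  rwa [timeDensity, Real.rpow_neg (P.pot_exp_pos ha hne).le, inv_inv] at h2

/-- The even profile with maximum `a`. -/
noncomputable def profile (ha : P.amp₀ ≤ a) (x : ℝ) : ℝ := a * Real.exp (-|P.logProfile ha x|)

noncomputable def profileDeriv (ha : P.amp₀ ≤ a) (x : ℝ) : ℝ :=
  -(SignType.sign (P.logProfile ha x) : ℝ) *
    (P.profile ha x * P.pot a (Real.exp (-|P.logProfile ha x|)) ^ (1 / 2 : ℝ))

theorem profile_pos (ha : P.amp₀ ≤ a) (x : ℝ) : 0 < P.profile ha x :=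
  mul_pos (P.amp₀_pos.trans_le ha) (Real.exp_pos _)

theorem continuous_exp_logProfile (ha : P.amp₀ ≤ a) :
    Continuous fun x => Real.exp (-|P.logProfile ha x|) :=
  Real.continuous_exp.comp (P.logProfile ha).continuous.abs.neg

theorem continuous_profile (ha : P.amp₀ ≤ a) : Continuous (P.profile ha) :=
  continuous_const.mul (P.continuous_exp_logProfile ha)

theorem hasDerivAt_exp_logProfile (ha : P.amp₀ ≤ a) {x : ℝ} (hx : x ≠ 0) :
    HasDerivAt (fun x => Real.exp (-|P.logProfile ha x|))
      (-(SignType.sign (P.logProfile ha x) : ℝ) * (Real.exp (-|P.logProfile ha x|) *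
        P.pot a (Real.exp (-|P.logProfile ha x|)) ^ (1 / 2 : ℝ))) x := by
  have h := (((hasDerivAt_abs (P.logProfile_ne_zero ha hx)).comp x
    (P.hasDerivAt_logProfile ha hx)).neg).exp
  refine h.congr_deriv ?_
  simp only [Pi.neg_apply, Function.comp_apply]
  ring

theorem hasDerivAt_profile_of_ne (ha : P.amp₀ ≤ a) {x : ℝ} (hx : x ≠ 0) :
    HasDerivAt (P.profile ha) (P.profileDeriv ha x) x := by
  refine ((P.hasDerivAt_exp_logProfile ha hx).const_mul a).congr_deriv ?_
  rw [profileDeriv, profile]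
  ring

theorem abs_profileDeriv_le (ha : P.amp₀ ≤ a) (x : ℝ) : |P.profileDeriv ha x| ≤
    P.profile ha x * P.pot a (Real.exp (-|P.logProfile ha x|)) ^ (1 / 2 : ℝ) := by
  have hD := P.pot_exp_nonneg ha (P.logProfile ha x)
  have n := mul_nonneg (P.profile_pos ha x).le (Real.rpow_nonneg hD (1 / 2))
  rw [profileDeriv, abs_mul, abs_neg, abs_of_nonneg n]
  refine mul_le_of_le_one_left n ?_
  rcases lt_trichotomy (P.logProfile ha x) 0 with h | h | h
  · simp [sign_neg h]
  · simp [h]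
  · simp [sign_pos h]

theorem continuousAt_profileDeriv_zero (ha : P.amp₀ ≤ a) :
    ContinuousAt (P.profileDeriv ha) 0 := by
  have h0 : P.profileDeriv ha 0 = 0 := by
    rw [profileDeriv, P.logProfile_zero]; simp
  have hc : Continuous fun x =>
      P.profile ha x * P.pot a (Real.exp (-|P.logProfile ha x|)) ^ (1 / 2 : ℝ) :=
    (P.continuous_profile ha).mul (((P.continuous_pot a).comp
      (P.continuous_exp_logProfile ha)).rpow_const fun _ => Or.inr (by norm_num))
  have ht := hc.tendsto 0
  simp only [P.logProfile_zero, abs_zero, neg_zero, Real.exp_zero, P.pot_one] at ht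
  rw [Real.zero_rpow (by norm_num), mul_zero] at ht
  rw [ContinuousAt, h0]
  exact squeeze_zero_norm (P.abs_profileDeriv_le ha) ht

theorem hasDerivAt_profile' (ha : P.amp₀ ≤ a) (x : ℝ) :
    HasDerivAt (P.profile ha) (P.profileDeriv ha x) x := by
  by_cases hx : x = 0
  · rw [hx]
    exact hasDerivAt_of_hasDerivAt_of_ne (fun y hy => P.hasDerivAt_profile_of_ne ha hy)
      (P.continuous_profile ha).continuousAt (P.continuousAt_profileDeriv_zero ha)
  · exact P.hasDerivAt_profile_of_ne ha hx

noncomputable def profileAccel (ha : P.amp₀ ≤ a) (x : ℝ) : ℝ :=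
  P.profile ha x * (P.freq a + P.profile ha x ^ P.α - P.profile ha x ^ P.β)

theorem continuous_profileAccel (ha : P.amp₀ ≤ a) : Continuous (P.profileAccel ha) := by
  have hc := P.continuous_profile ha
  exact hc.mul ((continuous_const.add (hc.rpow_const fun y => Or.inl (P.profile_pos ha y).ne')).sub
    (hc.rpow_const fun y => Or.inl (P.profile_pos ha y).ne'))

theorem hasDerivAt_profileDeriv_of_ne (ha : P.amp₀ ≤ a) {x : ℝ} (hx : x ≠ 0) :
    HasDerivAt (P.profileDeriv ha) (P.profileAccel ha x) x := by
  have ha0 := P.amp₀_pos.trans_le ha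
  have hne := P.logProfile_ne_zero ha hx
  have hD := P.pot_exp_pos ha hne
  have hs : HasDerivAt (fun y => (SignType.sign (P.logProfile ha y) : ℝ)) 0 x := by
    have : ∀ᶠ y in 𝓝 x, SignType.sign (P.logProfile ha y) =
        SignType.sign (P.logProfile ha x) :=
      ((continuousAt_sign_of_ne_zero hne).comp
        (P.logProfile ha).continuous.continuousAt).eventually_mem
          ((isOpen_discrete {SignType.sign (P.logProfile ha x)}).mem_nhds rfl)
    exact (hasDerivAt_const x (SignType.sign (P.logProfile ha x) : ℝ)).congr_of_eventuallyEq
      (this.mono fun y hy => congrArg _ hy)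
  have hs2 : (SignType.sign (P.logProfile ha x) : ℝ) ^ 2 = 1 := by
    rcases hne.lt_or_gt with h | h
    · simp [sign_neg h]
    · simp [sign_pos h]
  have hφ := P.hasDerivAt_profile' ha x
  have hp := P.profile_pos ha x
  have hpot : ∀ y, P.pot a (Real.exp (-|P.logProfile ha y|)) =
      P.freq a + P.b * P.profile ha y ^ P.α - P.c * P.profile ha y ^ P.β := fun y =>
    P.pot_eq ha0 (Real.exp_pos _).le
  have hpotd := (((hφ.rpow_const (p := P.α) (Or.inl hp.ne')).const_mul P.b).const_add
    (P.freq a)).sub ((hφ.rpow_const (p := P.β) (Or.inl hp.ne')).const_mul P.c)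
  have hpotd' : HasDerivAt (fun y => P.pot a (Real.exp (-|P.logProfile ha y|))) _ x :=
    hpotd.congr_of_eventuallyEq (Eventually.of_forall hpot)
  have h := hs.neg.mul (hφ.mul (hpotd'.rpow_const (p := 1 / 2) (Or.inl hD.ne')))
  refine h.congr_deriv ?_
  have e1 : P.pot a (Real.exp (-|P.logProfile ha x|)) ^ (1 / 2 : ℝ) *
      P.pot a (Real.exp (-|P.logProfile ha x|)) ^ (1 / 2 - 1 : ℝ) = 1 := by
    rw [← Real.rpow_add hD]; norm_num
  have e2 : (P.pot a (Real.exp (-|P.logProfile ha x|)) ^ (1 / 2 : ℝ)) ^ 2 =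
      P.freq a + P.b * P.profile ha x ^ P.α - P.c * P.profile ha x ^ P.β := by
    rw [← hpot, ← Real.rpow_natCast, ← Real.rpow_mul hD.le]; norm_num
  have r1 : P.profile ha x * P.profile ha x ^ (P.α - 1) = P.profile ha x ^ P.α := by
    rw [Real.rpow_sub_one hp.ne']; field_simp
  have r2 : P.profile ha x * P.profile ha x ^ (P.β - 1) = P.profile ha x ^ P.β := by
    rw [Real.rpow_sub_one hp.ne']; field_simp
  have hb : P.b * (P.α + 2) = 2 := div_mul_cancel₀ _ (by linarith [P.α_pos])
  have hc : P.c * (P.β + 2) = 2 := div_mul_cancel₀ _ (by linarith [P.β_pos])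
  simp only [profileDeriv, profileAccel, Pi.neg_apply, Pi.mul_apply]
  generalize P.pot a (Real.exp (-|P.logProfile ha x|)) ^ (1 / 2 : ℝ) = R at *
  generalize P.pot a (Real.exp (-|P.logProfile ha x|)) ^ (1 / 2 - 1 : ℝ) = Q at *
  generalize (SignType.sign (P.logProfile ha x) : ℝ) = s at *
  generalize P.profile ha x ^ (P.α - 1) = A' at *
  generalize P.profile ha x ^ (P.β - 1) = B' at *
  generalize P.profile ha x ^ P.α = A at *
  generalize P.profile ha x ^ P.β = B at *
  generalize P.profile ha x = f at *
  have lhs : -0 * (f * R) + -s * (-s * (f * R) * R + f *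
      ((P.b * (-s * (f * R) * P.α * A') - P.c * (-s * (f * R) * P.β * B')) * (1 / 2) * Q)) =
      s ^ 2 * (f * R ^ 2 + 1 / 2 * f * (R * Q) *
        (P.b * P.α * (f * A') - P.c * P.β * (f * B'))) := by ring
  refine lhs.trans ?_
  rw [hs2, e1, e2, r1, r2]
  linear_combination (f * A / 2) * hb - (f * B / 2) * hc

theorem hasDerivAt_profileDeriv (ha : P.amp₀ ≤ a) (x : ℝ) :
    HasDerivAt (P.profileDeriv ha) (P.profileAccel ha x) x := by
  by_cases hx : x = 0
  · rw [hx]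
    exact hasDerivAt_of_hasDerivAt_of_ne (fun y hy => P.hasDerivAt_profileDeriv_of_ne ha hy)
      (P.continuousAt_profileDeriv_zero ha) (P.continuous_profileAccel ha).continuousAt
  · exact P.hasDerivAt_profileDeriv_of_ne ha hx

theorem integrableOn_profile_sq (ha : P.amp₀ ≤ a) {s : Set ℝ} (hs : MeasurableSet s)
    (h0 : 0 ∉ s) (hinj : Set.InjOn (fun x => Real.exp (-|P.logProfile ha x|)) s) :
    IntegrableOn (fun x => P.profile ha x ^ 2) s := by
  have hne : ∀ x ∈ s, x ≠ 0 := fun x hx hx0 => h0 (hx0 ▸ hx)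
  have himg : (fun x => Real.exp (-|P.logProfile ha x|)) '' s ⊆ Set.Ioo 0 1 := by
    rintro _ ⟨x, hx, rfl⟩
    exact ⟨Real.exp_pos _, exp_neg_abs_lt_one (P.logProfile_ne_zero ha (hne x hx))⟩
  have h := (integrableOn_image_iff_integrableOn_abs_deriv_smul hs
    (fun x hx => (P.hasDerivAt_exp_logProfile ha (hne x hx)).hasDerivWithinAt) hinj
    (P.massIntegrand a)).1 ((P.integrableOn_massIntegrand ha).mono_set himg)
  refine h.congr_fun (fun x hx => ?_) hs
  have hl := P.logProfile_ne_zero ha (hne x hx)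
  have hD := P.pot_exp_pos ha hl
  have hsign : |(SignType.sign (P.logProfile ha x) : ℝ)| = 1 := by
    rcases hl.lt_or_gt with h | h
    · simp [sign_neg h]
    · simp [sign_pos h]
  have e1 : P.pot a (Real.exp (-|P.logProfile ha x|)) ^ (1 / 2 : ℝ) *
      P.pot a (Real.exp (-|P.logProfile ha x|)) ^ (-(1 / 2) : ℝ) = 1 := by
    rw [← Real.rpow_add hD]; norm_num
  simp only [massIntegrand, profile, smul_eq_mul]
  rw [abs_mul, abs_neg, hsign, abs_of_nonneg (mul_nonneg (Real.exp_pos _).le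
    (Real.rpow_nonneg hD.le _))]
  linear_combination (a * Real.exp (-|P.logProfile ha x|)) ^ 2 * e1

theorem integrable_profile_sq (ha : P.amp₀ ≤ a) : Integrable fun x => P.profile ha x ^ 2 := by
  have hm := (P.logProfile ha).strictMono
  have h1 : IntegrableOn (fun x => P.profile ha x ^ 2) (Set.Ioi 0) := by
    refine P.integrableOn_profile_sq ha measurableSet_Ioi Set.self_notMem_Ioi fun x hx y hy hxy => ?_
    have px : 0 < P.logProfile ha x := by rw [← P.logProfile_zero ha]; exact hm hx
    have py : 0 < P.logProfile ha y := by rw [← P.logProfile_zero ha]; exact hm hy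
    have := neg_injective (Real.exp_injective hxy)
    rw [abs_of_pos px, abs_of_pos py] at this
    exact hm.injective this
  have h2 : IntegrableOn (fun x => P.profile ha x ^ 2) (Set.Iio 0) := by
    refine P.integrableOn_profile_sq ha measurableSet_Iio Set.self_notMem_Iio fun x hx y hy hxy => ?_
    have px : P.logProfile ha x < 0 := by rw [← P.logProfile_zero ha]; exact hm hx
    have py : P.logProfile ha y < 0 := by rw [← P.logProfile_zero ha]; exact hm hy
    have := neg_injective (Real.exp_injective hxy)
    rw [abs_of_neg px, abs_of_neg py] at this
    exact hm.injective (neg_injective this)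
  rw [← integrableOn_Iic_iff_integrableOn_Iio] at h2
  have := h2.union h1
  rwa [Set.Iic_union_Ioi, integrableOn_univ] at this

theorem isStandingWaveProfile_profile (ha : P.amp₀ ≤ a) :
    IsStandingWaveProfile (P.α + 1) (P.β + 1) (P.freq a) (P.profile ha) := by
  have hd1 : deriv (P.profile ha) = P.profileDeriv ha :=
    funext fun x => (P.hasDerivAt_profile' ha x).deriv
  have hd2 : deriv (P.profileDeriv ha) = P.profileAccel ha :=
    funext fun x => (P.hasDerivAt_profileDeriv ha x).deriv
  have hc1 : Continuous (P.profileDeriv ha) :=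
    continuous_iff_continuousAt.2 fun x => (P.hasDerivAt_profileDeriv ha x).continuousAt
  have hC1 : ContDiff ℝ 1 (P.profileDeriv ha) := contDiff_one_iff_deriv.2
    ⟨fun x => (P.hasDerivAt_profileDeriv ha x).differentiableAt, by
      rw [hd2]; exact P.continuous_profileAccel ha⟩
  refine ⟨?_, P.profile_pos ha, ?_, ?_, fun x => ?_⟩
  · rw [← one_add_one_eq_two, contDiff_succ_iff_deriv, hd1]
    exact ⟨fun x => (P.hasDerivAt_profile' ha x).differentiableAt, by simp, hC1⟩
  · exact (memLp_two_iff_integrable_sq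
      (P.continuous_profile ha).aestronglyMeasurable).2 (P.integrable_profile_sq ha)
  · rw [hd1, memLp_two_iff_integrable_sq hc1.aestronglyMeasurable]
    refine Integrable.mono' ((P.integrable_profile_sq ha).mul_const
      (P.freq a + P.b * a ^ P.α)) (hc1.pow 2).aestronglyMeasurable
      (Eventually.of_forall fun x => ?_)
    have h1 := P.abs_profileDeriv_le ha x
    have h2 := P.pot_le ha (Real.exp_pos (-|P.logProfile ha x|)).le
      (Real.exp_le_one_iff.2 (neg_nonpos.2 (abs_nonneg _)))
    have h3 := P.pot_exp_nonneg ha (P.logProfile ha x)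
    rw [Real.norm_of_nonneg (sq_nonneg _), ← sq_abs]
    refine (pow_le_pow_left₀ (abs_nonneg _) h1 2).trans ?_
    rw [mul_pow, ← Real.sqrt_eq_rpow, Real.sq_sqrt h3]
    exact mul_le_mul_of_nonneg_left h2 (sq_nonneg _)
  · rw [hd1, hd2, add_sub_cancel_right, add_sub_cancel_right, abs_of_pos (P.profile_pos ha x),
      profileAccel]
    ring

end PowerPair

namespace PowerPair

/-! ### The derivative of the mass at zero frequency -/

variable (P : PowerPair) {φ : ℝ → ℝ → ℝ}

theorem standingWaveMass_eq
    (h : ∀ ω : ℝ, 0 < ω → IsStandingWaveProfile (P.α + 1) (P.β + 1) ω (φ ω)) {ω : ℝ}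
    (hω : 0 < ω) : standingWaveMass φ ω = P.halfIntegral (P.amp ω) := by
  rw [standingWaveMass, integral_profile_sq hω (h ω hω)]
  ring

theorem hasDerivAt_standingWaveMass
    (h : ∀ ω : ℝ, 0 < ω → IsStandingWaveProfile (P.α + 1) (P.β + 1) ω (φ ω)) {ω : ℝ}
    (hω : 0 < ω) : HasDerivAt (standingWaveMass φ)
      (P.halfIntegralDeriv (P.amp ω) * (P.freqDeriv (P.amp ω))⁻¹) ω := by
  refine ((P.hasDerivAt_halfIntegral (P.amp_gt hω)).comp ω
    (P.hasDerivAt_amp hω)).congr_of_eventuallyEq ?_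
  filter_upwards [eventually_gt_nhds hω] with x hx using P.standingWaveMass_eq h hx

theorem tendsto_deriv_standingWaveMass
    (h : ∀ ω : ℝ, 0 < ω → IsStandingWaveProfile (P.α + 1) (P.β + 1) ω (φ ω)) :
    Tendsto (fun ω => deriv (standingWaveMass φ) ω) (𝓝[>] 0)
      (𝓝 (P.halfIntegralDeriv P.amp₀ * (P.freqDeriv P.amp₀)⁻¹)) := by
  have h1 : Tendsto P.freqDeriv (𝓝[>] P.amp₀) (𝓝 (P.freqDeriv P.amp₀)) :=
    (P.continuousOn_freqDeriv.continuousAt (Ioi_mem_nhds P.amp₀_pos)).tendsto.mono_left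
      nhdsWithin_le_nhds
  refine ((P.tendsto_halfIntegralDeriv.mul
    (h1.inv₀ (P.freqDeriv_pos le_rfl).ne')).comp P.tendsto_amp).congr' ?_
  filter_upwards [self_mem_nhdsWithin] with ω hω
  exact (P.hasDerivAt_standingWaveMass h hω).deriv.symm

theorem limit_eq : ∃ k, 0 < k ∧
    P.halfIntegralDeriv P.amp₀ * (P.freqDeriv P.amp₀)⁻¹ = (4 - 2 * P.α - P.β) * k := by
  refine ⟨P.amp₀ * (∫ t in Set.Ioo 0 1, t ^ (1 - P.α) * P.pot P.amp₀ t ^ (-(1 / 2) : ℝ)) / 2 *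
    (P.freqDeriv P.amp₀)⁻¹, ?_, ?_⟩
  · exact mul_pos (half_pos (mul_pos P.amp₀_pos P.integral_rpow_mul_pot_pos))
      (inv_pos.2 (P.freqDeriv_pos le_rfl))
  · rw [P.halfIntegralDeriv_amp₀]
    ring

end PowerPair

theorem tendsto_sign_of_pos {ι : Type*} {f : ι → ℝ} {F : Filter ι} {l : ℝ}
    (h : Tendsto f F (𝓝 l)) (hl : 0 < l) : Tendsto (fun i => Real.sign (f i)) F (𝓝 1) :=
  tendsto_const_nhds.congr' ((h.eventually_const_lt hl).mono fun _ hi =>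
    (Real.sign_of_pos hi).symm)

theorem tendsto_sign_of_neg {ι : Type*} {f : ι → ℝ} {F : Filter ι} {l : ℝ}
    (h : Tendsto f F (𝓝 l)) (hl : l < 0) : Tendsto (fun i => Real.sign (f i)) F (𝓝 (-1)) :=
  tendsto_const_nhds.congr' ((h.eventually_lt_const hl).mono fun _ hi =>
    (Real.sign_of_neg hi).symm)

theorem corollary2p3 (p q : ℝ) (hp : 1 < p) (hpq : p < q) (hq : q < 5) (hp' : p < 7 / 3) :
    (∀ ω : ℝ, 0 < ω → ∃ φ : ℝ → ℝ, IsStandingWaveProfile p q ω φ) ∧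
    ∀ φ : ℝ → ℝ → ℝ, (∀ ω : ℝ, 0 < ω → IsStandingWaveProfile p q ω (φ ω)) →
      (∀ ω : ℝ, 0 < ω → DifferentiableAt ℝ (standingWaveMass φ) ω) ∧
      ∃ l : ℝ, Tendsto (fun ω => deriv (standingWaveMass φ) ω) (𝓝[>] 0) (𝓝 l) ∧
        (7 < 2 * p + q → Real.sign l = -1 ∧
          Tendsto (fun ω => Real.sign (deriv (standingWaveMass φ) ω)) (𝓝[>] 0) (𝓝 (-1))) ∧
        (2 * p + q = 7 → Real.sign l = 0) ∧
        (2 * p + q < 7 → Real.sign l = 1 ∧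
          Tendsto (fun ω => Real.sign (deriv (standingWaveMass φ) ω)) (𝓝[>] 0) (𝓝 1)) := by
  obtain ⟨P, rfl, rfl⟩ : ∃ P : PowerPair, p = P.α + 1 ∧ q = P.β + 1 :=
    ⟨⟨p - 1, q - 1, by linarith, by linarith, by linarith⟩, by ring, by ring⟩
  refine ⟨fun ω hω => ⟨P.profile (P.amp_gt hω).le, ?_⟩, fun φ h =>
    ⟨fun ω hω => (P.hasDerivAt_standingWaveMass h hω).differentiableAt, _,
      P.tendsto_deriv_standingWaveMass h, ?_⟩⟩
  · have := P.isStandingWaveProfile_profile (P.amp_gt hω).le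
    rwa [P.freq_amp hω] at this
  have ht := P.tendsto_deriv_standingWaveMass h
  obtain ⟨k, hk, he⟩ := P.limit_eq
  rw [he] at ht ⊢
  refine ⟨fun h7 => ?_, fun h7 => ?_, fun h7 => ?_⟩
  · have hl : (4 - 2 * P.α - P.β) * k < 0 := mul_neg_of_neg_of_pos (by linarith) hk
    exact ⟨Real.sign_of_neg hl, tendsto_sign_of_neg ht hl⟩
  · rw [show 4 - 2 * P.α - P.β = 0 by linarith, zero_mul, Real.sign_zero]
  · have hl : 0 < (4 - 2 * P.α - P.β) * k := mul_pos (by linarith) hk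
    exact ⟨Real.sign_of_pos hl, tendsto_sign_of_pos ht hl⟩
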